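/- Let $R$ be a commutative ring with unit. For $P\in R[[x,y]]$ with $P(0,0)=0$ and invertible linear $x$-coefficient, the image of $P$ in the iterated Laurent ring $R((x))((y))$ is invertible, so all powers $i_{x,y}P^n$, $n\in\mathbb Z$, are defined there. Let $f=\sum_{a,b,c\in\mathbb Z} f_{a,b,c}\,z_0^a z_1^b z_2^c$ be a bilateral series with coefficients in $R$. For units $u_0,u_1,u_2\in R((x))((y))$ write $i_{x,y}f(u_0,u_1,u_2)=\sum_{a,b,c} f_{a,b,c}\,u_0^a u_1^b u_2^c\in R[[x^{\pm1},y^{\pm1}]]$; this substitution *converges algebraically* if for all $m,n$ only finitely many $(a,b,c)$ contribute a nonzero term to the coefficient of $x^my^n$. Let $\operatorname{Res}_{z=0}g(z)\,dz$ be the coefficient of $z^{-1}$ in $g$. **(1)** If the substitutions $i_{x_1,x_2}f(x_1-x_2,x_1,x_2)$, $i_{x_2,x_1}f(x_1-x_2,x_1,x_2)$ and $i_{x_1,x_0}f(x_0,x_1,x_1-x_0)$ converge algebraically, then $$\operatorname{Res}_{x_1=0}\operatorname{Res}_{x_2=0}i_{x_1,x_2}f(x_1-x_2,x_1,x_2)\,dx_2\,dx_1-\operatorname{Res}_{x_2=0}\operatorname{Res}_{x_1=0}i_{x_2,x_1}f(x_1-x_2,x_1,x_2)\,dx_1\,dx_2=\operatorname{Res}_{x_1=0}\operatorname{Res}_{x_0=0}i_{x_1,x_0}f(x_0,x_1,x_1-x_0)\,dx_0\,dx_1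 .$$ **(2)** Let $F$ be a one-dimensional commutative formal group law over $R$, $\iota$ its inverse series ($F(z,\iota(z))=0$), $p_F(z)=F^{0,1}(z,0)^{-1}=\sum_{k\ge0}p_kz^k$, where $F^{0,1}$ is the partial derivative of $F$ in its second argument (so $p_F(z)\,dz$ is the invariant differential), and $\operatorname{Res}^F_{z=0}g(z)\,dz=\operatorname{Res}_{z=0}g(z)p_F(z)\,dz$. Suppose that the three products $$p_F(z_1)p_F(z_2)\, i_{z_1,z_2}f(F(z_1,\iota(z_2)),z_1,z_2),\quad p_F(z_1)p_F(z_2)\, i_{z_2,z_1}f(F(z_1,\iota(z_2)),z_1,z_2),\quad p_F(z_1)p_F(z_0)\, i_{z_1,z_0}f(z_0,z_1,F(z_1,\iota(z_0)))$$ converge algebraically, i.e. each coefficient, written as a sum over the monomials of $f$ and of the two factors $p_F$, has only finitely many nonzero terms. (As $p_0=1$, the three substitutions then converge algebraically themselves.) Then $$\operatorname{Res}^F_{z_1=0}\operatorname{Res}^F_{z_2=0}i_{z_1,z_2}f(F(z_1,\iota(z_2)),z_1,z_2)\,dz_2\,dz_1-\operatorname{Res}^F_{z_2=0}\operatorname{Res}^F_{z_1=0}i_{z_2,z_1}f(F(z_1,\iota(z_2)),z_1,z_2)\,dz_1\,dz_2=\operatorname{Res}^F_{z_1=0}\operatorname{Res}^F_{z_0=0}i_{z_1,z_0}f(z_0,z_1,F(z_1,\iota(z_0)))\,dz_0\,dz_1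 .$$ -/

import Mathlib

noncomputable section

namespace FRes

open MvPowerSeries

/-! ### The inverse series and the invariant differential of a formal group law -/

section FormalGroupLaw

variable {R : Type*} [CommRing R]

/-- `F(z, a(z))` for a power series `a` without constant term. -/
def evalSnd (F : FormalGroup R) (a : PowerSeries R) : PowerSeries R :=
  F.toPowerSeries.subst ![PowerSeries.X, a]

theorem hasSubst_pair {τ : Type*} {a b : MvPowerSeries τ R}
    (ha : MvPowerSeries.constantCoeff a = 0) (hb : MvPowerSeries.constantCoeff b = 0) :
    MvPowerSeries.HasSubst ![a, b] :=
  MvPowerSeries.hasSubst_of_constantCoeff_zero fun i => by fin_cases i <;> simpa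

theorem coeff_single_zero (F : FormalGroup R) (n : ℕ) :
    F.toPowerSeries.coeff (Finsupp.single 1 n) = if n = 1 then 1 else 0 := by
  have h := congrArg (PowerSeries.coeff n) F.zeroX_eq_X
  have hX : MvPowerSeries.constantCoeff (PowerSeries.X : PowerSeries R) = 0 :=
    PowerSeries.constantCoeff_X
  rw [PowerSeries.coeff_X, PowerSeries.coeff, FormalGroup.zeroX,
    coeff_subst (hasSubst_pair (map_zero _) hX), finsum_eq_single _ (Finsupp.single 1 n)] at h
  · rw [← h]
    simp only [Finsupp.prod_fintype, Fin.prod_univ_two, pow_zero, implies_true,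
      Matrix.cons_val_zero, Matrix.cons_val_one]
    have : PowerSeries.coeff n ((PowerSeries.X : PowerSeries R) ^ n) = 1 := by
      simp [PowerSeries.coeff_X_pow]
    simp only [PowerSeries.coeff] at this
    simp [this]
  · intro d hd
    by_cases hd0 : d 0 = 0
    · have h1 : d 1 ≠ n := by
        rintro rfl
        exact hd (by ext i; fin_cases i <;> simp [hd0])
      have : PowerSeries.coeff n ((PowerSeries.X : PowerSeries R) ^ (d 1)) = 0 := by
        simp [PowerSeries.coeff_X_pow, Ne.symm h1]
      simp only [PowerSeries.coeff] at this
      simp [Finsupp.prod_fintype, hd0, this]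
    · simp [Finsupp.prod_fintype, hd0]

/-- The coefficient of `z ^ n` in `F(z, a(z)) - a(z)` only depends on the coefficients of `a`
below `n`. -/
theorem evalSnd_contract (F : FormalGroup R) {a b : PowerSeries R}
    (ha : PowerSeries.constantCoeff a = 0) (hb : PowerSeries.constantCoeff b = 0) (n : ℕ)
    (h : ∀ m < n, PowerSeries.coeff m a = PowerSeries.coeff m b) :
    PowerSeries.coeff n (a - evalSnd F a) = PowerSeries.coeff n (b - evalSnd F b) := by
  have hX : MvPowerSeries.constantCoeff (PowerSeries.X : PowerSeries R) = 0 :=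
    PowerSeries.constantCoeff_X
  have Ha := hasSubst_pair hX ha
  have Hb := hasSubst_pair hX hb
  have key : PowerSeries.coeff n (evalSnd F a) - PowerSeries.coeff n (evalSnd F b)
      = PowerSeries.coeff n a - PowerSeries.coeff n b := by
    simp only [PowerSeries.coeff, evalSnd]
    rw [coeff_subst Ha, coeff_subst Hb,
      ← finsum_sub_distrib (coeff_subst_finite Ha _ _) (coeff_subst_finite Hb _ _),
      finsum_eq_single _ (Finsupp.single 1 1)]
    · simp [F.lin_coeff_Y]
    · intro d hd
      rw [← smul_sub]
      simp only [Finsupp.prod_fintype, Fin.prod_univ_two, pow_zero, implies_true,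
        Matrix.cons_val_zero, Matrix.cons_val_one]
      by_cases hd0 : d 0 = 0
      · have hdd : d = Finsupp.single 1 (d 1) := by
          ext i; fin_cases i <;> simp [hd0]
        have h1 : d 1 ≠ 1 := by
          intro h1
          rw [h1] at hdd
          exact hd hdd
        rw [hdd, coeff_single_zero]
        simp [h1]
      · have : PowerSeries.coeff n ((PowerSeries.X : PowerSeries R) ^ (d 0) * a ^ (d 1))
            = PowerSeries.coeff n ((PowerSeries.X : PowerSeries R) ^ (d 0) * b ^ (d 1)) := by
          rw [PowerSeries.coeff_X_pow_mul', PowerSeries.coeff_X_pow_mul']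
          split_ifs with hle
          · have hdvd : (PowerSeries.X : PowerSeries R) ^ n ∣ a - b :=
              PowerSeries.X_pow_dvd_iff.2 fun m hm => by rw [map_sub, h m hm, sub_self]
            have hdvd' := hdvd.trans (sub_dvd_pow_sub_pow a b (d 1))
            have := PowerSeries.X_pow_dvd_iff.1 hdvd' (n - d 0) (by omega)
            rwa [map_sub, sub_eq_zero] at this
          · rfl
        simp only [PowerSeries.coeff] at this
        rw [this, sub_self, smul_zero]
  rw [map_sub, map_sub]
  linear_combination -key

theorem constantCoeff_evalSnd (F : FormalGroup R) {a : PowerSeries R}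
    (ha : PowerSeries.constantCoeff a = 0) : PowerSeries.constantCoeff (evalSnd F a) = 0 := by
  have hX : MvPowerSeries.constantCoeff (PowerSeries.X : PowerSeries R) = 0 :=
    PowerSeries.constantCoeff_X
  refine MvPowerSeries.constantCoeff_subst_eq_zero (hasSubst_pair hX ha) (fun i => ?_)
    F.zero_constantCoeff
  fin_cases i
  · exact hX
  · exact ha

/-- Existence and uniqueness of the inverse `ι` of a formal group law: `F(z, ι(z)) = 0`. -/
theorem existsUnique_inverse (F : FormalGroup R) :
    ∃! i : PowerSeries R, PowerSeries.constantCoeff i = 0 ∧ evalSnd F i = 0 := by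
  let T : PowerSeries R → PowerSeries R := fun a => a - evalSnd F a
  have hT0 : ∀ k, PowerSeries.constantCoeff (T^[k] 0) = 0 := by
    intro k
    induction k with
    | zero => simp
    | succ k ih =>
      rw [Function.iterate_succ_apply']
      simp only [T, map_sub, ih, constantCoeff_evalSnd F ih, sub_self]
  have stab : ∀ n k, PowerSeries.coeff n (T^[n + 1 + k] 0) = PowerSeries.coeff n (T^[n + 1] 0) := by
    intro n
    induction n using Nat.strong_induction_on with
    | _ n ih =>
      intro k
      rw [show n + 1 + k = (n + k) + 1 by omega, Function.iterate_succ_apply',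
        Function.iterate_succ_apply']
      refine evalSnd_contract F (hT0 _) (hT0 _) n fun m hm => ?_
      have h1 := ih m hm (n + k - (m + 1))
      have h2 := ih m hm (n - (m + 1))
      rw [show m + 1 + (n + k - (m + 1)) = n + k by omega] at h1
      rw [show m + 1 + (n - (m + 1)) = n by omega] at h2
      rw [h1, h2]
  refine ⟨PowerSeries.mk fun n => PowerSeries.coeff n (T^[n + 1] 0), ⟨?_, ?_⟩, ?_⟩
  · rw [← PowerSeries.coeff_zero_eq_constantCoeff_apply, PowerSeries.coeff_mk,
      PowerSeries.coeff_zero_eq_constantCoeff_apply, hT0]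
  · have h0 : PowerSeries.constantCoeff
        (PowerSeries.mk fun n => PowerSeries.coeff n (T^[n + 1] 0)) = 0 := by
      rw [← PowerSeries.coeff_zero_eq_constantCoeff_apply, PowerSeries.coeff_mk,
        PowerSeries.coeff_zero_eq_constantCoeff_apply, hT0]
    ext n
    have := evalSnd_contract F h0 (hT0 n) n fun m hm => by
      have h2 := stab m (n - (m + 1))
      rw [show m + 1 + (n - (m + 1)) = n by omega] at h2
      rw [PowerSeries.coeff_mk, h2]
    rw [map_sub, PowerSeries.coeff_mk, Function.iterate_succ_apply'] at this
    simp only [T] at this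
    rw [map_zero]
    linear_combination -this
  · rintro b ⟨hb0, hb⟩
    ext n
    induction n using Nat.strong_induction_on with
    | _ n ih =>
      have := evalSnd_contract F hb0 (hT0 n) n fun m hm => by
        have h2 := stab m (n - (m + 1))
        rw [show m + 1 + (n - (m + 1)) = n by omega] at h2
        rw [ih m hm, PowerSeries.coeff_mk, h2]
      rw [hb, sub_zero] at this
      rw [this, PowerSeries.coeff_mk, Function.iterate_succ_apply']

/-- The inverse series `ι(z)` of the formal group law `F`. -/
def inverse (F : FormalGroup R) : PowerSeries R := (existsUnique_inverse F).choose

theorem constantCoeff_inverse (F : FormalGroup R) :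
    PowerSeries.constantCoeff (inverse F) = 0 := (existsUnique_inverse F).choose_spec.1.1

theorem evalSnd_inverse (F : FormalGroup R) : evalSnd F (inverse F) = 0 :=
  (existsUnique_inverse F).choose_spec.1.2

/-- `F(X i, ι(X j))` as a power series in the two variables `X 0`, `X 1`. -/
def diff (F : FormalGroup R) (i j : Fin 2) : MvPowerSeries (Fin 2) R :=
  F.toPowerSeries.subst ![X i, (inverse F).subst (X j : MvPowerSeries (Fin 2) R)]

/-- The series `p_F(z) = F^{0,1}(z, 0)⁻¹` with `θ_F = p_F(z) dz` the invariant differential. -/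
def invDiff (F : FormalGroup R) : PowerSeries R :=
  PowerSeries.invOfUnit
    (PowerSeries.mk fun m => F.toPowerSeries.coeff (Finsupp.single 0 m + Finsupp.single 1 1)) 1

theorem invDiff_spec (F : FormalGroup R) :
    (PowerSeries.mk fun m => F.toPowerSeries.coeff (Finsupp.single 0 m + Finsupp.single 1 1)) *
      invDiff F = 1 :=
  PowerSeries.mul_invOfUnit _ _ (by
    rw [← PowerSeries.coeff_zero_eq_constantCoeff_apply, PowerSeries.coeff_mk]
    simp [F.lin_coeff_Y])

theorem constantCoeff_invDiff (F : FormalGroup R) :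
    PowerSeries.constantCoeff (invDiff F) = 1 := by
  simp [invDiff]

/-- Linear coefficients of `F(a, b)`. -/
theorem coeff_subst_linear (F : FormalGroup R) {τ : Type*} {a b : MvPowerSeries τ R}
    (ha : MvPowerSeries.constantCoeff a = 0) (hb : MvPowerSeries.constantCoeff b = 0) (t : τ) :
    coeff (Finsupp.single t 1) (F.toPowerSeries.subst ![a, b]) =
      coeff (Finsupp.single t 1) a + coeff (Finsupp.single t 1) b := by
  classical
  have prod0 : ∀ u v : MvPowerSeries τ R, MvPowerSeries.constantCoeff u = 0 →
      MvPowerSeries.constantCoeff v = 0 → coeff (Finsupp.single t 1) (u * v) = 0 := by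
    intro u v hu hv
    rw [coeff_mul]
    refine Finset.sum_eq_zero fun p hp => ?_
    rw [Finset.HasAntidiagonal.mem_antidiagonal] at hp
    have hdeg := congrArg Finsupp.degree hp
    rw [map_add, Finsupp.degree_single] at hdeg
    rcases Nat.eq_zero_or_pos (Finsupp.degree p.1) with h | h
    · rw [Finsupp.degree_eq_zero_iff] at h
      rw [h, coeff_zero_eq_constantCoeff_apply, hu, zero_mul]
    · have h : Finsupp.degree p.2 = 0 := by omega
      rw [Finsupp.degree_eq_zero_iff] at h
      rw [h, coeff_zero_eq_constantCoeff_apply, hv, mul_zero]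
  have hne : (Finsupp.single 0 1 : Fin 2 →₀ ℕ) ≠ Finsupp.single 1 1 := by
    intro h
    simpa using DFunLike.congr_fun h 0
  rw [coeff_subst (hasSubst_pair ha hb),
    finsum_eq_sum_of_support_subset (s := {Finsupp.single 0 1, Finsupp.single 1 1}),
    Finset.sum_pair hne]
  · simp [Finsupp.prod_fintype, F.lin_coeff_X, F.lin_coeff_Y]
  · intro d hd
    by_contra hc
    apply hd
    simp only [Finset.coe_insert, Finset.coe_singleton, Set.mem_insert_iff,
      Set.mem_singleton_iff, not_or] at hc
    simp only [Finsupp.prod_fintype, Fin.prod_univ_two, pow_zero, implies_true,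
      Matrix.cons_val_zero, Matrix.cons_val_one]
    have hd01 : ∀ p q : ℕ, d 0 = p → d 1 = q →
        d = Finsupp.single 0 p + Finsupp.single 1 q := by
      intro p q hp hq
      ext i; fin_cases i <;> simp [hp, hq]
    rcases h0 : d 0 with _ | _ | p <;> rcases h1 : d 1 with _ | _ | q
    · simp [hd01 _ _ h0 h1, F.zero_constantCoeff]
    · exact absurd (by simpa using hd01 _ _ h0 h1) hc.2
    · rw [pow_zero, one_mul, pow_succ, prod0 _ _ (by simp [hb]) hb, smul_zero]
    · exact absurd (by simpa using hd01 _ _ h0 h1) hc.1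
    · rw [prod0 _ _ (by simp [ha]) (by simp [hb]), smul_zero]
    · rw [prod0 _ _ (by simp [ha]) (by simp [hb]), smul_zero]
    · rw [pow_zero, mul_one, pow_succ, prod0 _ _ (by simp [ha]) ha, smul_zero]
    · rw [prod0 _ _ (by simp [ha]) (by simp [hb]), smul_zero]
    · rw [prod0 _ _ (by simp [ha]) (by simp [hb]), smul_zero]

theorem coeff_one_inverse (F : FormalGroup R) : PowerSeries.coeff 1 (inverse F) = -1 := by
  have h := congrArg (PowerSeries.coeff 1) (evalSnd_inverse F)
  have hX : MvPowerSeries.constantCoeff (PowerSeries.X : PowerSeries R) = 0 :=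
    PowerSeries.constantCoeff_X
  have h1 := coeff_subst_linear F hX (constantCoeff_inverse F) ()
  change PowerSeries.coeff 1 (evalSnd F (inverse F)) =
    PowerSeries.coeff 1 PowerSeries.X + PowerSeries.coeff 1 (inverse F) at h1
  rw [h1, PowerSeries.coeff_one_X, map_zero] at h
  linear_combination h

theorem constantCoeff_inverse_subst (F : FormalGroup R) (j : Fin 2) :
    MvPowerSeries.constantCoeff ((inverse F).subst (X j : MvPowerSeries (Fin 2) R)) = 0 :=
  PowerSeries.constantCoeff_subst_eq_zero (by simp) _ (constantCoeff_inverse F)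

theorem constantCoeff_diff (F : FormalGroup R) (i j : Fin 2) :
    MvPowerSeries.constantCoeff (diff F i j) = 0 := by
  have h := constantCoeff_inverse_subst F j
  refine MvPowerSeries.constantCoeff_subst_eq_zero (hasSubst_pair (by simp) h) (fun k => ?_)
    F.zero_constantCoeff
  fin_cases k
  · simp
  · exact h

theorem isUnit_linear_diff (F : FormalGroup R) {i j : Fin 2} (hij : i ≠ j) (t : Fin 2) :
    IsUnit (coeff (Finsupp.single t 1) (diff F i j)) := by
  rw [diff, coeff_subst_linear F (by simp) (constantCoeff_inverse_subst F j),
    PowerSeries.coeff_subst_single, coeff_index_single_X]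
  by_cases h : t = j
  · subst h
    simp [hij.symm, coeff_one_inverse]
  · have : t = i := by omega
    subst this
    have h2 : Finsupp.single t 1 ≠ Finsupp.single j ((Finsupp.single t 1 : Fin 2 →₀ ℕ) j) := by
      intro hh
      have := DFunLike.congr_fun hh t
      simp [Ne.symm h] at this
    rw [if_neg h2]
    simp

end FormalGroupLaw

/-! ### The iterated Laurent ring and expansions -/

section Expansion

variable (R : Type*) [CommRing R]

/-- The iterated Laurent ring `R((x))((y))`; `x` is the inner and `y` the outer variable. -/
abbrev IterLaurent : Type _ := LaurentSeries (LaurentSeries R)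

variable {R}

/-- The coefficient of `x ^ m * y ^ n` in an element of `R((x))((y))`. -/
def iterCoeff (g : IterLaurent R) (m n : ℤ) : R := (g.coeff n).coeff m

/-- The inclusion of `R[[x, y]]` (with `x = X 0`, `y = X 1`) into `R((x))((y))`. -/
def toIter (P : MvPowerSeries (Fin 2) R) : IterLaurent R :=
  HahnSeries.ofPowerSeries ℤ (LaurentSeries R) <| PowerSeries.mk fun n =>
    HahnSeries.ofPowerSeries ℤ R <| PowerSeries.mk fun m =>
      P.coeff (Finsupp.single 0 m + Finsupp.single 1 n)

theorem isUnit_laurent {A : Type*} [CommRing A] (g : LaurentSeries A) (k : ℤ)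
    (h0 : ∀ n < k, g.coeff n = 0) (hk : IsUnit (g.coeff k)) : IsUnit g := by
  rcases subsingleton_or_nontrivial A with hA | hA
  · have : g = 1 := by ext n; exact Subsingleton.elim _ _
    rw [this]
    exact isUnit_one
  · have hne : g.coeff k ≠ 0 := hk.ne_zero
    have hg : g ≠ 0 := by
      rintro rfl
      simp at hne
    have ho : g.order = k := by
      refine le_antisymm (HahnSeries.order_le_of_coeff_ne_zero hne) ?_
      by_contra hlt
      have := h0 g.order (not_le.1 hlt)
      exact HahnSeries.coeff_order_eq_zero.not.2 hg this
    refine HahnSeries.isUnit_of_isUnit_leadingCoeff_AddUnitOrder ?_ (AddGroup.isAddUnit _)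
    rwa [HahnSeries.leadingCoeff_eq, ho]

/-- A power series in `x, y` whose linear `x`-coefficient is a unit becomes invertible in
`R((x))((y))` when it has no constant term. -/
theorem isUnit_toIter {P : MvPowerSeries (Fin 2) R} (h0 : MvPowerSeries.constantCoeff P = 0)
    (h1 : IsUnit (coeff (Finsupp.single 0 1) P)) : IsUnit (toIter P) := by
  refine isUnit_laurent _ 0 (fun n hn => ?_) ?_
  · exact PowerSeries.coeff_coe _ _ |>.trans (if_pos hn)
  · refine isUnit_laurent _ 1 (fun n hn => ?_) ?_
    · rw [toIter, PowerSeries.coeff_coe, if_neg (lt_irrefl _), PowerSeries.coeff_mk,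
        PowerSeries.coeff_coe]
      split_ifs with h
      · rfl
      · have : n = 0 := by omega
        subst this
        simp [h0]
    · rw [toIter, PowerSeries.coeff_coe, if_neg (lt_irrefl _), PowerSeries.coeff_mk,
        PowerSeries.coeff_coe, if_neg (by omega), PowerSeries.coeff_mk]
      simpa using h1

/-- The inner variable `x` as a unit of `R((x))((y))`. -/
def innerVar : (IterLaurent R)ˣ :=
  (isUnit_laurent (HahnSeries.single 0 (HahnSeries.single 1 1) : IterLaurent R) 0
    (fun n hn => HahnSeries.coeff_single_of_ne hn.ne) (by
      rw [HahnSeries.coeff_single_same]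
      exact isUnit_laurent _ 1 (fun n hn => HahnSeries.coeff_single_of_ne hn.ne)
        (by simp))).unit

/-- The outer variable `y` as a unit of `R((x))((y))`. -/
def outerVar : (IterLaurent R)ˣ :=
  (isUnit_laurent (HahnSeries.single 1 1 : IterLaurent R) 1
    (fun n hn => HahnSeries.coeff_single_of_ne hn.ne) (by simp)).unit

/-- `x - y` as a unit of `R((x))((y))`. -/
def subInnerOuter : (IterLaurent R)ˣ :=
  (isUnit_toIter (P := X 0 - X 1) (by simp) (by simp [coeff_index_single_X])).unit

/-- `y - x` as a unit of `R((x))((y))`. -/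
def subOuterInner : (IterLaurent R)ˣ :=
  (isUnit_toIter (P := X 1 - X 0) (by simp) (by simp [coeff_index_single_X])).unit

/-- `F(x, ι(y))` as a unit of `R((x))((y))`. -/
def diffInnerOuter (F : FormalGroup R) : (IterLaurent R)ˣ :=
  (isUnit_toIter (constantCoeff_diff F 0 1) (isUnit_linear_diff F (by decide) 0)).unit

/-- `F(y, ι(x))` as a unit of `R((x))((y))`. -/
def diffOuterInner (F : FormalGroup R) : (IterLaurent R)ˣ :=
  (isUnit_toIter (constantCoeff_diff F 1 0) (isUnit_linear_diff F (by decide) 0)).unit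

end Expansion

/-! ### Substitution into trivariate bilateral series, and residues -/

section Substitution

variable {R : Type*} [CommRing R]

/-- For `f = ∑ a_e z₀^e₀ z₁^e₁ z₂^e₂`, the summand `a_e u₀^e₀ u₁^e₁ u₂^e₂` of `f(u₀, u₁, u₂)`. -/
def substTerm (f : (Fin 3 → ℤ) → R) (u : Fin 3 → (IterLaurent R)ˣ) (e : Fin 3 → ℤ) :
    IterLaurent R :=
  f e • ((∏ i, u i ^ e i : (IterLaurent R)ˣ) : IterLaurent R)

/-- The substitution `f(u₀, u₁, u₂)` converges algebraically: every coefficient is a sum with only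
finitely many nonzero terms. -/
def SubstConverges (f : (Fin 3 → ℤ) → R) (u : Fin 3 → (IterLaurent R)ˣ) : Prop :=
  ∀ m n : ℤ, {e : Fin 3 → ℤ | iterCoeff (substTerm f u e) m n ≠ 0}.Finite

/-- The bilateral series `f(u₀, u₁, u₂)` in two variables; `substitute f u m n` is the coefficient
of `x ^ m * y ^ n`. -/
def substitute (f : (Fin 3 → ℤ) → R) (u : Fin 3 → (IterLaurent R)ˣ) (m n : ℤ) : R :=
  ∑ᶠ e : Fin 3 → ℤ, iterCoeff (substTerm f u e) m n

/-- `p_F` as a bilateral series. -/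
def invDiffCoeff (F : FormalGroup R) (n : ℤ) : R :=
  (HahnSeries.ofPowerSeries ℤ R (invDiff F)).coeff n

/-- The product `p_F(x) p_F(y) f(u₀, u₁, u₂)` converges algebraically: every coefficient, as
a sum over the monomials of `f`, of `p_F(x)` and of `p_F(y)`, has only finitely many nonzero
terms. -/
def FSubstConverges (F : FormalGroup R) (f : (Fin 3 → ℤ) → R) (u : Fin 3 → (IterLaurent R)ˣ) :
    Prop :=
  ∀ m n : ℤ, {t : (Fin 3 → ℤ) × ℤ × ℤ |
    invDiffCoeff F t.2.1 * (invDiffCoeff F t.2.2 *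
      iterCoeff (substTerm f u t.1) (m - t.2.1) (n - t.2.2)) ≠ 0}.Finite

theorem FSubstConverges.substConverges {F : FormalGroup R} {f : (Fin 3 → ℤ) → R}
    {u : Fin 3 → (IterLaurent R)ˣ} (h : FSubstConverges F f u) : SubstConverges f u := by
  intro m n
  have h0 : invDiffCoeff F 0 = 1 := by
    rw [invDiffCoeff, PowerSeries.coeff_coe, if_neg (lt_irrefl _)]
    simp [constantCoeff_invDiff]
  refine ((h m n).preimage (f := fun e => (e, (0 : ℤ), (0 : ℤ)))
    (fun _ _ _ _ hab => (Prod.ext_iff.1 hab).1)).subset fun e he => ?_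
  simpa [h0] using he

/-- The product of two bilateral series in one variable. -/
def bilateralMul (g h : ℤ → R) (k : ℤ) : R := ∑ᶠ i : ℤ, g i * h (k - i)

/-- The residue of a bilateral series: the coefficient of `z⁻¹`. -/
def residue (g : ℤ → R) : R := g (-1)

/-- The `F`-residue: the residue of `g(z) θ_F = g(z) p_F(z) dz`. -/
def fResidue (F : FormalGroup R) (g : ℤ → R) : R := residue (bilateralMul (invDiffCoeff F) g)

end Substitution

end FRes

end

/-!
# The residue identity for formal group laws

The convergence hypotheses make all sums over the monomials of `f` (and over those of `p_F`)
finite, so that both identities may be checked for a single monomial `f = z₀ᵃ z₁ᵇ z₂ᶜ`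
(`fResidue_fResidue_substitute`, `finsum_sub_eq_finsum`).

For a monomial, the difference `F(x, ι(y))` vanishes on the diagonal, hence is `(x - y) w(x, y)`
with `w` invertible (`exists_diff_eq`). The first two residues are therefore the residues of one and
the same element `h(x₁, x₂) (x₁ - x₂)ᵃ x₁ᵇ x₂ᶜ` of `R[[x₁, x₂]][x₁⁻¹, x₂⁻¹, (x₁ - x₂)⁻¹]`, where
`h = wᵃ p_F(x₁) p_F(x₂)`, expanded in two ways. The third is the residue of the same differential
form in the coordinates `x₁`, `x₀`, where `x₂ = Φ(x₁, x₀) = F(x₁, ι(x₀))`: the invariance of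
`p_F(z) dz` identifies `p_F(x₂) dx₂` with `-p_F(x₀) dx₀` (`pderiv_sub_diff_mul_invDiff`), and
`F(x₁, ι(x₂)) = x₀` (`diff_subst_diff`).

The difference of the first two residues and the third one are linear in the element
(`monomialRes_sub_monomialRes`). Both vanish if there is no pole along `x₁ = x₂`, and the order of
this pole can be lowered until only the elements `g(x₁) x₁ᵇ (x₁ - x₂)⁻ᵐ⁻¹` are left
(`eq_zero_of_pole_reduction`). For these the first residue is zero, the second one is computed from
a geometric series (`monomialRes_swap_pole`), and the third one (`monomialRes_subst_pole`) comes
down to the fact that `t⁻ᵐ⁻¹ dt` has residue `1` for `m = 0` and `0` for `m > 0`, if `t = x₁ - x₂`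
is expressed in another coordinate `x₀`. Over an arbitrary ring this follows from the case of
independent coefficients over `ℤ`, where one can integrate (`coeff_inv_pow_mul_derivative`).
-/

noncomputable section

namespace FRes

open MvPowerSeries

/-! ### The residue of `t⁻ᵐ⁻¹ dt` -/

section ResidueChange

/-- The torsion-free case, where `t⁻ᵐ⁻¹ dt` is `-d(t⁻ᵐ) / m`. -/
theorem coeff_inv_pow_mul_derivative_of_torsionFree {A : Type*} [CommRing A] [IsAddTorsionFree A]
    (V : (PowerSeries A)ˣ) {m : ℕ} (hm : m ≠ 0) :
    PowerSeries.coeff m (((V⁻¹ ^ (m + 1) : (PowerSeries A)ˣ) : PowerSeries A) *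
      PowerSeries.derivative A (PowerSeries.X * (V : PowerSeries A))) = 0 := by
  set q : PowerSeries A := ((V⁻¹ : (PowerSeries A)ˣ) : PowerSeries A) with hq
  have hqV : q * V = 1 := V.inv_mul
  have hdq : PowerSeries.derivative A q = -q ^ 2 * PowerSeries.derivative A V :=
    PowerSeries.derivative_inv V
  have e1 : ((V⁻¹ ^ (m + 1) : (PowerSeries A)ˣ) : PowerSeries A) *
      PowerSeries.derivative A (PowerSeries.X * (V : PowerSeries A)) =
      q ^ m + PowerSeries.X * (q ^ (m + 1) * PowerSeries.derivative A V) := by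
    rw [Units.val_pow_eq_pow_val, Derivation.leibniz, PowerSeries.derivative_X]
    simp only [smul_eq_mul, mul_one]
    linear_combination q ^ m * hqV
  have e2 : PowerSeries.derivative A (q ^ m) =
      -((m : PowerSeries A) * (q ^ (m + 1) * PowerSeries.derivative A V)) := by
    obtain ⟨k, rfl⟩ := Nat.exists_eq_succ_of_ne_zero hm
    rw [PowerSeries.derivative_pow, hdq, Nat.succ_eq_add_one, Nat.add_sub_cancel]
    ring
  obtain ⟨k, rfl⟩ := Nat.exists_eq_succ_of_ne_zero hm
  rw [e1, map_add, Nat.succ_eq_add_one, PowerSeries.coeff_succ_X_mul]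
  have e3 := congrArg (PowerSeries.coeff k) e2
  rw [PowerSeries.coeff_derivative, map_neg, ← nsmul_eq_mul, map_nsmul, nsmul_eq_mul] at e3
  have hk : (k + 1) ≠ 0 := hm
  rw [← smul_right_inj hk, nsmul_eq_mul, smul_zero]
  push_cast at e3 ⊢
  linear_combination e3

/-- For `t = z V(z)` with `V` invertible, the residue of `t⁻ᵐ⁻¹ dt` vanishes unless `m = 0`, over
every commutative ring. After `V` is scaled to have constant term `1`, the identity is the image of
the one with independent coefficients, where the base ring `ℤ[c₀, c₁, …]` is torsion-free. -/
theorem coeff_inv_pow_mul_derivative {A : Type*} [CommRing A] (V : (PowerSeries A)ˣ) (m : ℕ) :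
    PowerSeries.coeff m (((V⁻¹ ^ (m + 1) : (PowerSeries A)ˣ) : PowerSeries A) *
      PowerSeries.derivative A (PowerSeries.X * (V : PowerSeries A))) = if m = 0 then 1 else 0 := by
  split_ifs with hm
  · subst hm
    rw [Derivation.leibniz, PowerSeries.derivative_X, smul_eq_mul, smul_eq_mul, mul_one, mul_add]
    rw [PowerSeries.coeff_zero_eq_constantCoeff_apply, map_add, zero_add, pow_one, V.inv_mul]
    simp
  · -- the normalised series, and the generic series specialising to it
    obtain ⟨c, hc⟩ : ∃ c : Aˣ, (c : A) = PowerSeries.constantCoeff (V : PowerSeries A) :=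
      ⟨Units.map (PowerSeries.constantCoeff (R := A)).toMonoidHom V, rfl⟩
    let W : PowerSeries (MvPolynomial ℕ ℤ) := 1 + PowerSeries.X * PowerSeries.mk MvPolynomial.X
    have hWu : IsUnit W := PowerSeries.isUnit_iff_constantCoeff.2 (by simp [W])
    let ev : MvPolynomial ℕ ℤ →+* A := MvPolynomial.eval₂Hom (Int.castRingHom A) fun n =>
      ((c⁻¹ : Aˣ) : A) * PowerSeries.coeff (n + 1) (V : PowerSeries A)
    have hV : V = Units.map (PowerSeries.C (R := A)).toMonoidHom c *
        Units.map (PowerSeries.map ev).toMonoidHom hWu.unit := by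
      ext n
      simp only [Units.val_mul, Units.coe_map, RingHom.toMonoidHom_eq_coe, MonoidHom.coe_coe,
        IsUnit.unit_spec, PowerSeries.coeff_C_mul, PowerSeries.coeff_map]
      cases n with
      | zero => simp [W, hc]
      | succ n =>
        simp [W, PowerSeries.coeff_succ_X_mul, ev, PowerSeries.coeff_one]
    have h0 := congrArg ev (coeff_inv_pow_mul_derivative_of_torsionFree hWu.unit hm)
    have hder : ∀ G : PowerSeries (MvPolynomial ℕ ℤ),
        PowerSeries.derivative A (PowerSeries.map ev G)
        = PowerSeries.map ev (PowerSeries.derivative _ G) := by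
      intro G
      ext n
      simp [PowerSeries.coeff_derivative]
    rw [map_zero, ← PowerSeries.coeff_map, map_mul (PowerSeries.map ev), ← hder,
      map_mul (PowerSeries.map ev), PowerSeries.map_X] at h0
    have key : ((V⁻¹ ^ (m + 1) : (PowerSeries A)ˣ) : PowerSeries A) *
        PowerSeries.derivative A (PowerSeries.X * (V : PowerSeries A)) =
        PowerSeries.C (((c⁻¹ ^ m : Aˣ) : A)) *
          (PowerSeries.map ev ((hWu.unit⁻¹ ^ (m + 1) : (PowerSeries (MvPolynomial ℕ ℤ))ˣ) :
            PowerSeries (MvPolynomial ℕ ℤ)) *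
          PowerSeries.derivative A (PowerSeries.X * PowerSeries.map ev hWu.unit)) := by
      have hC : PowerSeries.X * (V : PowerSeries A) =
          (c : A) • (PowerSeries.X * PowerSeries.map ev hWu.unit) := by
        conv_lhs => rw [hV]
        rw [PowerSeries.smul_eq_C_mul]
        simp only [Units.val_mul, Units.coe_map, RingHom.toMonoidHom_eq_coe, MonoidHom.coe_coe]
        ring
      rw [hC, Derivation.map_smul, PowerSeries.smul_eq_C_mul]
      have hinv : ((V⁻¹ ^ (m + 1) : (PowerSeries A)ˣ) : PowerSeries A) =
          PowerSeries.C (((c⁻¹ ^ (m + 1) : Aˣ) : A)) *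
          PowerSeries.map ev ((hWu.unit⁻¹ ^ (m + 1) : (PowerSeries (MvPolynomial ℕ ℤ))ˣ) :
            PowerSeries (MvPolynomial ℕ ℤ)) := by
        conv_lhs => rw [hV]
        have h1 := map_pow (Units.map (PowerSeries.C (R := A)).toMonoidHom) c⁻¹ (m + 1)
        have h2 := map_pow (Units.map (PowerSeries.map ev).toMonoidHom) hWu.unit⁻¹ (m + 1)
        rw [mul_inv, mul_pow, ← map_inv, ← map_inv, ← h1, ← h2]
        rfl
      have hcc : PowerSeries.C (((c⁻¹ ^ (m + 1) : Aˣ) : A)) * PowerSeries.C (c : A) =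
          PowerSeries.C (((c⁻¹ ^ m : Aˣ) : A)) := by
        rw [← map_mul, ← Units.val_mul, pow_succ, inv_mul_cancel_right]
      rw [hinv, ← hcc]
      ring
    rw [key, PowerSeries.coeff_C_mul, h0, mul_zero]

end ResidueChange

/-! ### Partial derivatives and divided differences of power series -/

section ChainRule

variable {R : Type*} [CommRing R]

theorem continuous_pderiv {σ : Type*} [TopologicalSpace R] [IsTopologicalRing R] (i : σ) :
    @Continuous _ _ (MvPowerSeries.WithPiTopology.instTopologicalSpace (σ := σ) R)
      (MvPowerSeries.WithPiTopology.instTopologicalSpace (σ := σ) R) (pderiv R i) := by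
  let := MvPowerSeries.WithPiTopology.instTopologicalSpace (σ := σ) R
  refine continuous_pi fun d => ?_
  have : (fun f : MvPowerSeries σ R => pderiv R i f d) =
      fun f => coeff (d + Finsupp.single i 1) f * ((d i : R) + 1) :=
    funext fun f => coeff_pderiv f d
  rw [this]
  exact (MvPowerSeries.WithPiTopology.continuous_coeff R _).mul continuous_const

/-- The chain rule for the substitution of power series. It holds for polynomials by the Leibniz
rule, both sides are continuous for the topology of coefficientwise stabilisation, and polynomials
are dense. -/
theorem pderiv_subst {σ τ : Type*} [Fintype σ] {a : σ → MvPowerSeries τ R}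
    (ha : MvPowerSeries.HasSubst a) (G : MvPowerSeries σ R) (t : τ) :
    pderiv R t (G.subst a) = ∑ i, (pderiv R i G).subst a * pderiv R t (a i) := by
  classical
  let : UniformSpace R := ⊥
  have : DiscreteUniformity R := ⟨rfl⟩
  have : DiscreteTopology R := inferInstance
  let := MvPowerSeries.WithPiTopology.instTopologicalSpace (σ := σ) R
  let := MvPowerSeries.WithPiTopology.instTopologicalSpace (σ := τ) R
  have : T2Space (MvPowerSeries τ R) := MvPowerSeries.WithPiTopology.instT2Space
  have : IsTopologicalRing (MvPowerSeries τ R) :=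
    MvPowerSeries.WithPiTopology.instIsTopologicalRing τ R
  have hs : Continuous (MvPowerSeries.subst a : MvPowerSeries σ R → MvPowerSeries τ R) :=
    MvPowerSeries.continuous_subst ha
  have hpoly : ∀ p : MvPolynomial σ R, pderiv R t ((p : MvPowerSeries σ R).subst a) =
      ∑ i, (pderiv R i (p : MvPowerSeries σ R)).subst a * pderiv R t (a i) := by
    intro p
    induction p using MvPolynomial.induction_on with
    | C r =>
      have h0 : (0 : MvPowerSeries σ R).subst a = 0 := by rw [← coe_substAlgHom ha, map_zero]
      rw [MvPolynomial.coe_C, subst_C, pderiv_C]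
      simp [h0]
    | add p q hp hq =>
      simp only [MvPolynomial.coe_add, subst_add ha, map_add, hp, hq, add_mul,
        Finset.sum_add_distrib]
    | mul_X p j hp =>
      have hX : ∀ i, (pderiv R i (X j : MvPowerSeries σ R)).subst a =
          if i = j then (1 : MvPowerSeries τ R) else 0 := by
        intro i
        split_ifs with h
        · subst h
          rw [pderiv_X_self, ← coe_substAlgHom ha, map_one]
        · rw [pderiv_X_of_ne (Ne.symm h), ← coe_substAlgHom ha, map_zero]
      simp only [MvPolynomial.coe_mul, MvPolynomial.coe_X, subst_mul ha, subst_X ha,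
        Derivation.leibniz, smul_eq_mul, hp, subst_add ha, hX, add_mul, Finset.sum_add_distrib,
        mul_ite, mul_one, mul_zero, ite_mul, zero_mul, Finset.sum_ite_eq', Finset.mem_univ, if_true,
        Finset.mul_sum, mul_assoc]
  have hcont : Continuous fun f : MvPowerSeries σ R =>
      ∑ i, (pderiv R i f).subst a * pderiv R t (a i) :=
    continuous_finsetSum _ fun i _ => (hs.comp (continuous_pderiv i)).mul continuous_const
  exact congrFun (MvPowerSeries.WithPiTopology.denseRange_toMvPowerSeries.equalizer
    ((continuous_pderiv t).comp hs) hcont (funext hpoly)) G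

/-- Splitting off the part of a power series that does not depend on the second variable. -/
theorem exists_eq_add_X_mul (G : MvPowerSeries (Fin 2) R) :
    ∃ G' : MvPowerSeries (Fin 2) R,
      G = (PowerSeries.mk fun n => coeff (Finsupp.single 0 n) G).toMvPowerSeries 0 + X 1 * G' := by
  have hdvd : (X 1 : MvPowerSeries (Fin 2) R) ∣
      G - (PowerSeries.mk fun n => coeff (Finsupp.single 0 n) G).toMvPowerSeries 0 := by
    refine X_dvd_iff.2 fun m hm => ?_
    have hmm : m = Finsupp.single 0 (m 0) := by
      ext i; fin_cases i <;> simp [hm]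
    rw [hmm, map_sub, PowerSeries.toMvPowerSeries_eq_subst, PowerSeries.coeff_subst_single]
    simp
  obtain ⟨G', hG'⟩ := hdvd
  exact ⟨G', sub_eq_iff_eq_add'.1 hG'⟩

theorem subst_pair_subst {σ τ : Type*} {a b : MvPowerSeries σ R} {c : σ → MvPowerSeries τ R}
    (ha : MvPowerSeries.constantCoeff a = 0) (hb : MvPowerSeries.constantCoeff b = 0)
    (hc : MvPowerSeries.HasSubst c) (G : MvPowerSeries (Fin 2) R) :
    (G.subst ![a, b]).subst c = G.subst ![a.subst c, b.subst c] := by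
  rw [subst_comp_subst_apply (hasSubst_pair ha hb) hc]
  congr 1
  funext s
  fin_cases s <;> rfl

theorem subst_zero_right {τ : Type*} {a : MvPowerSeries τ R}
    (ha : MvPowerSeries.constantCoeff a = 0) (G : MvPowerSeries (Fin 2) R) :
    G.subst ![a, 0] = (PowerSeries.mk fun n => coeff (Finsupp.single 0 n) G).subst a := by
  have hs : MvPowerSeries.HasSubst ![a, 0] := hasSubst_pair ha (map_zero _)
  obtain ⟨G', hG'⟩ := exists_eq_add_X_mul G
  conv_lhs => rw [hG']
  rw [subst_add hs, subst_mul hs, subst_X hs, PowerSeries.subst_toMvPowerSeries hs]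
  simp

/-- A power series `h(x, y)` splits as `h(x, x) + (x - y) h'(x, y)`. -/
theorem exists_eq_add_sub_mul (h : MvPowerSeries (Fin 2) R) :
    ∃ (g : PowerSeries R) (h' : MvPowerSeries (Fin 2) R),
      h = g.toMvPowerSeries 0 + (X 0 - X 1) * h' := by
  -- the involution `(x, y) ↦ (x, x - y)` turns this into the splitting off of the part
  -- independent of the second variable
  have hs : MvPowerSeries.HasSubst ![(X 0 : MvPowerSeries (Fin 2) R), X 0 - X 1] :=
    hasSubst_pair (by simp) (by simp)
  let G := h.subst ![(X 0 : MvPowerSeries (Fin 2) R), X 0 - X 1]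
  obtain ⟨G', hG'⟩ := exists_eq_add_X_mul G
  generalize (PowerSeries.mk fun n => coeff (Finsupp.single 0 n) G) = g at hG'
  refine ⟨g, G'.subst ![(X 0 : MvPowerSeries (Fin 2) R), X 0 - X 1], ?_⟩
  have hback : G.subst ![(X 0 : MvPowerSeries (Fin 2) R), X 0 - X 1] = h := by
    rw [subst_pair_subst (by simp) (by simp) hs, subst_sub hs, subst_X hs, subst_X hs]
    have : ![![(X 0 : MvPowerSeries (Fin 2) R), X 0 - X 1] 0,
        ![(X 0 : MvPowerSeries (Fin 2) R), X 0 - X 1] 0 -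
          ![(X 0 : MvPowerSeries (Fin 2) R), X 0 - X 1] 1] = X := by
      funext s
      fin_cases s <;> simp
    rw [this, subst_self, id]
  rw [← hback, hG', subst_add hs, subst_mul hs, subst_X hs, PowerSeries.subst_toMvPowerSeries hs]
  simp [PowerSeries.toMvPowerSeries_eq_subst]

end ChainRule

/-! ### The difference `F(x, ι(y))` of a formal group law -/

section FormalDifference

variable {R : Type*} [CommRing R] (F : FormalGroup R) {τ : Type*}

theorem constantCoeff_subst_pair {a b : MvPowerSeries τ R}
    (ha : MvPowerSeries.constantCoeff a = 0) (hb : MvPowerSeries.constantCoeff b = 0) :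
    MvPowerSeries.constantCoeff (F.toPowerSeries.subst ![a, b]) = 0 :=
  MvPowerSeries.constantCoeff_subst_eq_zero (hasSubst_pair ha hb)
    (fun i => by fin_cases i <;> simpa) F.zero_constantCoeff

theorem constantCoeff_subst_inverse {a : MvPowerSeries τ R}
    (ha : MvPowerSeries.constantCoeff a = 0) :
    MvPowerSeries.constantCoeff ((inverse F).subst a) = 0 :=
  PowerSeries.constantCoeff_subst_eq_zero ha _ (constantCoeff_inverse F)

theorem subst_inverse_self {a : MvPowerSeries τ R} (ha : MvPowerSeries.constantCoeff a = 0) :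
    F.toPowerSeries.subst ![a, (inverse F).subst a] = 0 := by
  have hs : PowerSeries.HasSubst a := PowerSeries.HasSubst.of_constantCoeff_zero ha
  have h := congrArg (PowerSeries.subst a) (evalSnd_inverse F)
  rw [← PowerSeries.coe_substAlgHom hs, map_zero, PowerSeries.coe_substAlgHom hs, evalSnd,
    PowerSeries.subst, subst_pair_subst PowerSeries.constantCoeff_X (constantCoeff_inverse F)
      hs.const] at h
  rw [← h]
  congr 2
  exact (PowerSeries.subst_X hs).symm

theorem diff_subst {a b : MvPowerSeries τ R} (ha : MvPowerSeries.constantCoeff a = 0)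
    (hb : MvPowerSeries.constantCoeff b = 0) (i j : Fin 2) :
    (diff F i j).subst ![a, b] =
      F.toPowerSeries.subst ![![a, b] i, (inverse F).subst (![a, b] j)] := by
  have hs := hasSubst_pair ha hb
  rw [diff, subst_pair_subst (by simp) (constantCoeff_inverse_subst F j) hs, subst_X hs,
    ← PowerSeries.toMvPowerSeries_eq_subst, PowerSeries.subst_toMvPowerSeries hs]

theorem diff_swap : (diff F 0 1).subst ![(X 1 : MvPowerSeries (Fin 2) R), X 0] = diff F 1 0 := by
  rw [diff_subst F (by simp) (by simp)]
  rfl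

/-- `F(x, ι(y))` is divisible by `x - y`, since it vanishes for `x = y`. -/
theorem exists_diff_eq : ∃ w : (MvPowerSeries (Fin 2) R)ˣ,
    diff F 0 1 = (X 0 - X 1 : MvPowerSeries (Fin 2) R) * (w : MvPowerSeries (Fin 2) R) := by
  obtain ⟨g, w, hw⟩ := exists_eq_add_sub_mul (diff F 0 1)
  have hX : MvPowerSeries.constantCoeff (PowerSeries.X : PowerSeries R) = 0 :=
    PowerSeries.constantCoeff_X
  have hs : MvPowerSeries.HasSubst ![(PowerSeries.X : PowerSeries R), PowerSeries.X] :=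
    hasSubst_pair hX hX
  have h := congrArg (MvPowerSeries.subst ![(PowerSeries.X : PowerSeries R), PowerSeries.X]) hw
  rw [diff_subst F hX hX, subst_add hs, subst_mul hs, subst_sub hs, subst_X hs, subst_X hs,
    PowerSeries.subst_toMvPowerSeries hs] at h
  have hg : g = 0 := by
    have h2 := subst_inverse_self F hX
    simp only [Matrix.cons_val_zero, Matrix.cons_val_one, sub_self, zero_mul, add_zero, h2] at h
    rw [h]
    have h3 := PowerSeries.map_algebraMap_eq_subst_X (R := R) (S := R) g
    rw [← h3]
    simp
  rw [hg, map_zero, zero_add] at hw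
  have hu : IsUnit w := by
    rw [isUnit_iff_constantCoeff]
    have h1 := isUnit_linear_diff F (show (0 : Fin 2) ≠ 1 by decide) 0
    have h2 : coeff (Finsupp.single 0 1) ((X 1 : MvPowerSeries (Fin 2) R) * w) = 0 := by
      rw [X_def, coeff_monomial_mul, if_neg]
      intro hle
      simpa using hle 1
    have h3 : coeff (Finsupp.single 0 1) ((X 0 : MvPowerSeries (Fin 2) R) * w) =
        constantCoeff w := by
      have := coeff_add_monomial_mul (Finsupp.single (0 : Fin 2) 1) 0 w (1 : R)
      rwa [add_zero, one_mul, coeff_zero_eq_constantCoeff_apply] at this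
    rwa [hw, sub_mul, map_sub, h2, h3, sub_zero] at h1
  exact ⟨hu.unit, hw⟩

variable [F.IsComm]

/-- `(x - y) + y = x` for the formal group law. -/
theorem subst_diff_add : F.toPowerSeries.subst ![diff F 0 1, X 1] = X 0 := by
  have h0 : MvPowerSeries.constantCoeff (X 0 : MvPowerSeries (Fin 2) R) = 0 := by simp
  have h1 : MvPowerSeries.constantCoeff (X 1 : MvPowerSeries (Fin 2) R) = 0 := by simp
  have hi := constantCoeff_subst_inverse F h1
  have hs : ∀ {a : MvPowerSeries (Fin 2) R}, MvPowerSeries.constantCoeff a = 0 →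
    PowerSeries.HasSubst a := fun h => PowerSeries.HasSubst.of_constantCoeff_zero h
  rw [diff, F.assoc' (hs h0) (hs hi) (hs h1), F.comm' (hs hi) (hs h1), subst_inverse_self F h1,
    F.add_zero (hs h0)]

/-- `x - (x - y) = y` for the formal group law. -/
theorem diff_subst_diff :
    (diff F 0 1).subst ![(X 0 : MvPowerSeries (Fin 2) R), diff F 0 1] = X 1 := by
  have h0 : MvPowerSeries.constantCoeff (X 0 : MvPowerSeries (Fin 2) R) = 0 := by simp
  have h1 : MvPowerSeries.constantCoeff (X 1 : MvPowerSeries (Fin 2) R) = 0 := by simp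
  have hd := constantCoeff_diff F 0 1
  have hs : ∀ {a : MvPowerSeries (Fin 2) R}, MvPowerSeries.constantCoeff a = 0 →
    PowerSeries.HasSubst a := fun h => PowerSeries.HasSubst.of_constantCoeff_zero h
  rw [diff_subst F h0 hd]
  change F.toPowerSeries.subst ![X 0, (inverse F).subst (diff F 0 1)] = X 1
  conv_lhs =>
    rw [← subst_diff_add F, F.comm' (hs hd) (hs h1),
      F.assoc' (hs h1) (hs hd) (hs (constantCoeff_subst_inverse F hd)), subst_inverse_self F hd,
      F.add_zero (hs h1)]

end FormalDifference

/-! ### Invariance of the differential -/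

section Invariance

variable {R : Type*} [CommRing R] (F : FormalGroup R) {τ : Type*}

theorem pderiv_subst_zero_mul_invDiff {a : MvPowerSeries τ R}
    (ha : MvPowerSeries.constantCoeff a = 0) :
    (pderiv R 1 F.toPowerSeries).subst ![a, 0] * (invDiff F).subst a = 1 := by
  have hs : PowerSeries.HasSubst a := PowerSeries.HasSubst.of_constantCoeff_zero ha
  have h := congrArg (PowerSeries.subst a) (invDiff_spec F)
  rw [← PowerSeries.coe_substAlgHom hs, map_one, map_mul, PowerSeries.coe_substAlgHom hs] at h
  rw [subst_zero_right ha, ← h]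
  congr 3
  funext n
  simp [coeff_pderiv]

/-- Differentiating associativity in the last variable: the vector field `F^{0,1}(z, 0) d/dz` is
invariant under translation. -/
theorem pderiv_subst_mul {a b : MvPowerSeries τ R} (ha : MvPowerSeries.constantCoeff a = 0)
    (hb : MvPowerSeries.constantCoeff b = 0) :
    (pderiv R 1 F.toPowerSeries).subst ![F.toPowerSeries.subst ![a, b], 0] =
      (pderiv R 1 F.toPowerSeries).subst ![a, b] *
        (pderiv R 1 F.toPowerSeries).subst ![b, 0] := by
  have hX : ∀ i, MvPowerSeries.constantCoeff (X i : MvPowerSeries (Fin 3) R) = 0 := by simp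
  have h01 := constantCoeff_subst_pair F (hX 0) (hX 1)
  have h12 := constantCoeff_subst_pair F (hX 1) (hX 2)
  have h := congrArg (pderiv R (2 : Fin 3)) F.assoc
  rw [pderiv_subst (hasSubst_pair h01 (hX 2)), pderiv_subst (hasSubst_pair (hX 0) h12)] at h
  simp only [Fin.sum_univ_two, Matrix.cons_val_zero, Matrix.cons_val_one] at h
  rw [pderiv_subst (hasSubst_pair (hX 0) (hX 1)), pderiv_subst (hasSubst_pair (hX 1) (hX 2))] at h
  simp only [Fin.sum_univ_two, Matrix.cons_val_zero, Matrix.cons_val_one, pderiv_X_self,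
    pderiv_X_of_ne (show (0 : Fin 3) ≠ 2 by decide),
    pderiv_X_of_ne (show (1 : Fin 3) ≠ 2 by decide), mul_zero, mul_one, zero_add, add_zero] at h
  have hs : MvPowerSeries.HasSubst ![a, b, 0] :=
    MvPowerSeries.hasSubst_of_constantCoeff_zero fun i => by fin_cases i <;> simp [ha, hb]
  have h2 := congrArg (MvPowerSeries.subst ![a, b, 0]) h
  rw [subst_mul hs, subst_pair_subst h01 (hX 2) hs, subst_pair_subst (hX 0) h12 hs,
    subst_pair_subst (hX 0) (hX 1) hs, subst_pair_subst (hX 1) (hX 2) hs,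
    subst_pair_subst (hX 1) (hX 2) hs, subst_X hs, subst_X hs, subst_X hs] at h2
  change (pderiv R 1 F.toPowerSeries).subst ![F.toPowerSeries.subst ![a, b], 0] =
    (pderiv R 1 F.toPowerSeries).subst ![a, F.toPowerSeries.subst ![b, 0]] *
      (pderiv R 1 F.toPowerSeries).subst ![b, 0] at h2
  rwa [F.add_zero (PowerSeries.HasSubst.of_constantCoeff_zero hb)] at h2

theorem pderiv_zero_subst [F.IsComm] {a b : MvPowerSeries τ R}
    (ha : MvPowerSeries.constantCoeff a = 0) (hb : MvPowerSeries.constantCoeff b = 0) :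
    (pderiv R 0 F.toPowerSeries).subst ![a, b] = (pderiv R 1 F.toPowerSeries).subst ![b, a] := by
  have hX : ∀ i, MvPowerSeries.constantCoeff (X i : MvPowerSeries (Fin 2) R) = 0 := by simp
  have h := congrArg (pderiv R (0 : Fin 2)) (FormalGroup.IsComm.comm (F := F))
  rw [pderiv_subst (hasSubst_pair (hX 1) (hX 0))] at h
  simp only [Fin.sum_univ_two, Matrix.cons_val_zero, Matrix.cons_val_one, pderiv_X_self,
    pderiv_X_of_ne (show (1 : Fin 2) ≠ 0 by decide), mul_zero, mul_one, zero_add] at h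
  have hs := hasSubst_pair ha hb
  rw [h, subst_pair_subst (hX 1) (hX 0) hs, subst_X hs, subst_X hs]
  rfl

/-- The invariant differential changes sign under `y ↦ F(x, ι(y))`. -/
theorem pderiv_sub_diff_mul_invDiff [F.IsComm] :
    pderiv R 1 ((X 0 : MvPowerSeries (Fin 2) R) - diff F 0 1) * (invDiff F).subst (diff F 0 1) =
      (invDiff F).subst (X 1 : MvPowerSeries (Fin 2) R) := by
  have h0 : MvPowerSeries.constantCoeff (X 0 : MvPowerSeries (Fin 2) R) = 0 := by simp
  have h1 : MvPowerSeries.constantCoeff (X 1 : MvPowerSeries (Fin 2) R) = 0 := by simp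
  have hd := constantCoeff_diff F 0 1
  -- with `D = F^{0,1}` and `Φ = F(x, ι(y))`, the derivative of `F(Φ, y) = x` in `y` relates
  -- `∂Φ/∂y` to `D(y, Φ)` and `D(Φ, y)`, which are quotients of the values of `D(·, 0)`
  have h := congrArg (pderiv R (1 : Fin 2)) (subst_diff_add F)
  rw [pderiv_subst (hasSubst_pair hd h1)] at h
  simp only [Fin.sum_univ_two, Matrix.cons_val_zero, Matrix.cons_val_one, pderiv_X_self,
    pderiv_X_of_ne (show (0 : Fin 2) ≠ 1 by decide), mul_one, pderiv_zero_subst F hd h1] at h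
  have e1 := pderiv_subst_mul F hd h1
  have e2 := pderiv_subst_mul F h1 hd
  rw [F.comm' (PowerSeries.HasSubst.of_constantCoeff_zero h1)
    (PowerSeries.HasSubst.of_constantCoeff_zero hd)] at e2
  rw [subst_diff_add F] at e1 e2
  have p0 := pderiv_subst_zero_mul_invDiff F h0
  have p1 := pderiv_subst_zero_mul_invDiff F h1
  have pd := pderiv_subst_zero_mul_invDiff F hd
  rw [map_sub, pderiv_X_of_ne (show (0 : Fin 2) ≠ 1 by decide), zero_sub]
  generalize (pderiv R 1 F.toPowerSeries).subst ![diff F 0 1, X 1] = a at *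
  generalize (pderiv R 1 F.toPowerSeries).subst ![X 1, diff F 0 1] = b at *
  generalize (pderiv R 1 F.toPowerSeries).subst ![(X 0 : MvPowerSeries (Fin 2) R), 0] = f0 at *
  generalize (pderiv R 1 F.toPowerSeries).subst ![(X 1 : MvPowerSeries (Fin 2) R), 0] = f1 at *
  generalize (pderiv R 1 F.toPowerSeries).subst ![diff F 0 1, 0] = fd at *
  generalize (invDiff F).subst (X 0 : MvPowerSeries (Fin 2) R) = q0 at *
  generalize (invDiff F).subst (X 1 : MvPowerSeries (Fin 2) R) = q1 at *
  generalize (invDiff F).subst (diff F 0 1) = qd at *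
  generalize pderiv R 1 (diff F 0 1) = t at *
  -- `b t + a = 0`, `f0 = a f1 = b fd`, and `f0`, `f1`, `fd` have the inverses `q0`, `q1`, `qd`
  have k0 : f0 * (t * qd + q1) = 0 := by
    linear_combination h + t * qd * e2 + q1 * e1 + a * p1 + b * t * pd
  linear_combination -(q0 * k0) + (t * qd + q1) * p0

end Invariance

/-! ### Power series inside the iterated Laurent ring -/

section Embedding

variable {R : Type*} [CommRing R]

/-- The exchange of the two variables of `R[[x, y]]`. -/
def swapVars : MvPowerSeries (Fin 2) R →ₐ[R] MvPowerSeries (Fin 2) R :=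
  rename (Equiv.swap (0 : Fin 2) 1)

/-- The inclusion of `R[[x, y]]` into `R((x))[[y]]`, through `R[[y, x]] = R[[x]][[y]]`. -/
def toOuter : MvPowerSeries (Fin 2) R →+* PowerSeries (LaurentSeries R) :=
  (PowerSeries.map ((HahnSeries.ofPowerSeries ℤ R).comp
    (renameEquiv R (Equiv.ofUnique (Fin 1) Unit) :
      MvPowerSeries (Fin 1) R →+* MvPowerSeries Unit R))).comp
    ((finSuccEquiv R 1 : MvPowerSeries (Fin 2) R →+* PowerSeries (MvPowerSeries (Fin 1) R)).comp
      (swapVars (R := R)).toRingHom)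

theorem coeff_swapVars (G : MvPowerSeries (Fin 2) R) (m n : ℕ) :
    coeff (Finsupp.single 0 m + Finsupp.single 1 n) (swapVars G) =
      coeff (Finsupp.single 0 n + Finsupp.single 1 m) G := by
  have h := coeff_embDomain_rename (R := R) (Equiv.swap (0 : Fin 2) 1).toEmbedding G
    (Finsupp.single 0 n + Finsupp.single 1 m)
  rw [← h, Finsupp.embDomain_eq_mapDomain, Finsupp.mapDomain_add, Finsupp.mapDomain_single,
    Finsupp.mapDomain_single, add_comm]
  simp [swapVars]

theorem swapVars_X_zero : swapVars (X 0 : MvPowerSeries (Fin 2) R) = X 1 := by simp [swapVars]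

theorem swapVars_X_one : swapVars (X 1 : MvPowerSeries (Fin 2) R) = X 0 := by simp [swapVars]

theorem swapVars_eq_subst (G : MvPowerSeries (Fin 2) R) : swapVars G = G.subst ![X 1, X 0] := by
  rw [swapVars, rename_eq_subst]
  congr 1
  funext i
  fin_cases i <;> simp

theorem coeff_coeff_toOuter (G : MvPowerSeries (Fin 2) R) (n : ℕ) :
    PowerSeries.coeff n (toOuter G) = HahnSeries.ofPowerSeries ℤ R
      (PowerSeries.mk fun m => G.coeff (Finsupp.single 0 m + Finsupp.single 1 n)) := by
  simp only [toOuter, RingHom.comp_apply, PowerSeries.coeff_map]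
  congr 1
  ext m
  rw [PowerSeries.coeff_mk, ← coeff_swapVars]
  have h := coeff_embDomain_rename (R := R) (Equiv.ofUnique (Fin 1) Unit).toEmbedding
    (PowerSeries.coeff n (finSuccEquiv R 1 (swapVars G))) (Finsupp.single 0 m)
  rw [coeff_coeff_finSuccEquiv, Finsupp.embDomain_single] at h
  refine h.trans (congrArg (fun d => coeff d (swapVars G)) ?_)
  ext i
  fin_cases i <;> simp [Finsupp.cons]

theorem toIter_eq (G : MvPowerSeries (Fin 2) R) :
    toIter G = HahnSeries.ofPowerSeries ℤ (LaurentSeries R) (toOuter G) := by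
  rw [toIter]
  congr 1
  ext n : 1
  rw [PowerSeries.coeff_mk, coeff_coeff_toOuter]

/-- The inclusion of `R[[x, y]]` into `R((x))((y))` as a ring homomorphism. -/
def toIterHom : MvPowerSeries (Fin 2) R →+* IterLaurent R :=
  (HahnSeries.ofPowerSeries ℤ (LaurentSeries R)).comp toOuter

theorem toIterHom_apply (G : MvPowerSeries (Fin 2) R) : toIterHom G = toIter G :=
  (toIter_eq G).symm

theorem coeff_ofPowerSeries {A : Type*} [CommRing A] (G : PowerSeries A) (n : ℤ) :
    (HahnSeries.ofPowerSeries ℤ A G).coeff n =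
      if n < 0 then 0 else PowerSeries.coeff n.natAbs G :=
  PowerSeries.coeff_coe G n

theorem iterCoeff_toIter (G : MvPowerSeries (Fin 2) R) (m n : ℤ) :
    iterCoeff (toIter G) m n = if m < 0 ∨ n < 0 then 0 else
      coeff (Finsupp.single 0 m.natAbs + Finsupp.single 1 n.natAbs) G := by
  rw [iterCoeff, toIter, coeff_ofPowerSeries]
  by_cases hn : n < 0
  · simp [hn]
  · rw [if_neg hn, PowerSeries.coeff_mk, coeff_ofPowerSeries]
    simp [hn]

theorem iterCoeff_toIter_swapVars (G : MvPowerSeries (Fin 2) R) (m n : ℤ) :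
    iterCoeff (toIter (swapVars G)) m n = iterCoeff (toIter G) n m := by
  rw [iterCoeff_toIter, iterCoeff_toIter, coeff_swapVars]
  simp only [or_comm]

theorem toOuter_toMvPowerSeries_zero (g : PowerSeries R) :
    toOuter (g.toMvPowerSeries 0) = PowerSeries.C (HahnSeries.ofPowerSeries ℤ R g) := by
  ext n : 1
  rw [coeff_coeff_toOuter, PowerSeries.coeff_C, PowerSeries.toMvPowerSeries_eq_subst]
  split_ifs with hn
  · subst hn
    congr 1
    ext m
    rw [PowerSeries.coeff_mk, Finsupp.single_zero, add_zero, PowerSeries.coeff_subst_single]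
    simp
  · rw [show (PowerSeries.mk fun m => coeff (Finsupp.single 0 m + Finsupp.single 1 n)
      (PowerSeries.subst (X 0 : MvPowerSeries (Fin 2) R) g)) = 0 from ?_, map_zero]
    ext m
    rw [PowerSeries.coeff_mk, PowerSeries.coeff_subst_single, if_neg, map_zero]
    intro h
    simpa [hn] using DFunLike.congr_fun h 1

theorem toOuter_toMvPowerSeries_one (g : PowerSeries R) :
    toOuter (g.toMvPowerSeries 1) = PowerSeries.map HahnSeries.C g := by
  ext n : 1
  rw [coeff_coeff_toOuter, PowerSeries.coeff_map, PowerSeries.toMvPowerSeries_eq_subst,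
    ← HahnSeries.ofPowerSeries_C]
  congr 1
  ext m
  rw [PowerSeries.coeff_mk, PowerSeries.coeff_subst_single, PowerSeries.coeff_C]
  by_cases hm : m = 0
  · subst hm
    simp
  · rw [if_neg, if_neg hm]
    intro h
    simpa [hm] using DFunLike.congr_fun h 0

theorem toOuter_X_zero : toOuter (X 0 : MvPowerSeries (Fin 2) R) =
    PowerSeries.C (HahnSeries.single 1 1) := by
  rw [← PowerSeries.toMvPowerSeries_X, toOuter_toMvPowerSeries_zero, HahnSeries.ofPowerSeries_X]

theorem toOuter_X_one : toOuter (X 1 : MvPowerSeries (Fin 2) R) = PowerSeries.X := by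
  rw [← PowerSeries.toMvPowerSeries_X, toOuter_toMvPowerSeries_one, PowerSeries.map_X]

theorem toOuter_pderiv (G : MvPowerSeries (Fin 2) R) :
    toOuter (pderiv R 1 G) = PowerSeries.derivative _ (toOuter G) := by
  ext n m
  rw [PowerSeries.coeff_derivative, coeff_coeff_toOuter, coeff_coeff_toOuter, ← Nat.cast_succ,
    mul_comm, ← nsmul_eq_mul, HahnSeries.coeff_nsmul, Pi.smul_apply, coeff_ofPowerSeries,
    coeff_ofPowerSeries]
  split_ifs
  · simp
  · rw [PowerSeries.coeff_mk, PowerSeries.coeff_mk, coeff_pderiv, nsmul_eq_mul, mul_comm,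
      add_assoc, ← Finsupp.single_add]
    simp

end Embedding

/-! ### Monomials and residues in the iterated Laurent ring -/

section Residue

variable {R : Type*} [CommRing R]

theorem val_zpow_eq {M : Type*} [Monoid M] (u : Mˣ) (s : ℤ → M) (h0 : s 0 = 1)
    (h1 : ∀ b, s (b + 1) = s b * u) (b : ℤ) : ((u ^ b : Mˣ) : M) = s b := by
  induction b using Int.induction_on with
  | zero => simp [h0]
  | succ k ih => rw [zpow_add_one, Units.val_mul, ih, h1]
  | pred k ih =>
    have := h1 (-(k : ℤ) - 1)
    rw [sub_add_cancel] at this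
    rw [zpow_sub_one, Units.val_mul, ih, this, Units.mul_inv_cancel_right]

theorem val_innerVar : ((innerVar : (IterLaurent R)ˣ) : IterLaurent R) =
    HahnSeries.single 0 (HahnSeries.single 1 1) := rfl

theorem val_outerVar : ((outerVar : (IterLaurent R)ˣ) : IterLaurent R) =
    HahnSeries.single 1 1 := rfl

theorem val_innerVar_zpow (b : ℤ) : ((innerVar ^ b : (IterLaurent R)ˣ) : IterLaurent R) =
    HahnSeries.C (HahnSeries.single b 1) := by
  refine val_zpow_eq _ (fun b => HahnSeries.C (HahnSeries.single b 1)) ?_ (fun b => ?_) b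
  · exact map_one (HahnSeries.C (Γ := ℤ) (R := LaurentSeries R))
  · rw [val_innerVar, HahnSeries.C_apply, HahnSeries.C_apply, HahnSeries.single_mul_single,
      HahnSeries.single_mul_single, add_zero, mul_one]

theorem val_outerVar_zpow (c : ℤ) : ((outerVar ^ c : (IterLaurent R)ˣ) : IterLaurent R) =
    HahnSeries.single c 1 := by
  refine val_zpow_eq _ (fun c => HahnSeries.single c 1) rfl (fun c => ?_) c
  rw [val_outerVar, HahnSeries.single_mul_single, mul_one]

theorem iterCoeff_mul_outerVar_zpow (g : IterLaurent R) (c m n : ℤ) :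
    iterCoeff (g * ((outerVar ^ c : (IterLaurent R)ˣ) : IterLaurent R)) m n =
      iterCoeff g m (n - c) := by
  have := HahnSeries.coeff_mul_single_add (r := (1 : LaurentSeries R)) (x := g) (a := n - c)
    (b := c)
  rw [sub_add_cancel, mul_one] at this
  rw [iterCoeff, val_outerVar_zpow, this, iterCoeff]

theorem iterCoeff_C_mul (s : LaurentSeries R) (g : IterLaurent R) (m n : ℤ) :
    iterCoeff (HahnSeries.C s * g) m n = (s * g.coeff n).coeff m := by
  rw [iterCoeff, HahnSeries.C_mul_eq_smul, HahnSeries.coeff_smul, smul_eq_mul]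

theorem iterCoeff_mul_innerVar_zpow (g : IterLaurent R) (b m n : ℤ) :
    iterCoeff (g * ((innerVar ^ b : (IterLaurent R)ˣ) : IterLaurent R)) m n =
      iterCoeff g (m - b) n := by
  have := HahnSeries.coeff_mul_single_add (r := (1 : R)) (x := g.coeff n) (a := m - b) (b := b)
  rw [sub_add_cancel, mul_one] at this
  rw [mul_comm, val_innerVar_zpow, iterCoeff_C_mul, mul_comm, this, iterCoeff]

/-- The iterated residue: the coefficient of `x⁻¹ y⁻¹`. -/
def iterRes : IterLaurent R →+ R where
  toFun g := iterCoeff g (-1) (-1)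
  map_zero' := by simp [iterCoeff]
  map_add' g h := by simp [iterCoeff]

theorem iterRes_apply (g : IterLaurent R) : iterRes g = iterCoeff g (-1) (-1) := rfl

/-- The units of `R((x))[[y]]`, as a subgroup of the units of `R((x))((y))`. -/
def regularUnits : Subgroup (IterLaurent R)ˣ :=
  (Units.map (HahnSeries.ofPowerSeries ℤ (LaurentSeries R)).toMonoidHom).range

theorem val_mem_range {u : (IterLaurent R)ˣ} (hu : u ∈ regularUnits) :
    (u : IterLaurent R) ∈ (HahnSeries.ofPowerSeries ℤ (LaurentSeries R)).range := by
  obtain ⟨V, rfl⟩ := hu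
  exact ⟨V, rfl⟩

/-- There is no residue in `y` on `R((x))[[y]]`. -/
theorem iterRes_eq_zero {g : IterLaurent R}
    (hg : g ∈ (HahnSeries.ofPowerSeries ℤ (LaurentSeries R)).range) : iterRes g = 0 := by
  obtain ⟨G, rfl⟩ := hg
  rw [iterRes_apply, iterCoeff, coeff_ofPowerSeries]
  simp

theorem toIter_mem_range (G : MvPowerSeries (Fin 2) R) :
    toIter G ∈ (HahnSeries.ofPowerSeries ℤ (LaurentSeries R)).range :=
  ⟨toOuter G, (toIter_eq G).symm⟩

theorem isUnit_single_one : IsUnit (HahnSeries.single 1 1 : LaurentSeries R) :=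
  isUnit_laurent _ 1 (fun n hn => HahnSeries.coeff_single_of_ne hn.ne) (by simp)

theorem mem_regularUnits {u : (IterLaurent R)ˣ} {v : MvPowerSeries (Fin 2) R}
    (hu : (u : IterLaurent R) = toIter (X 0 - X 1 * v)) : u ∈ regularUnits := by
  have hV : IsUnit (toOuter (X 0 - X 1 * v : MvPowerSeries (Fin 2) R)) := by
    rw [PowerSeries.isUnit_iff_constantCoeff, map_sub, map_mul, toOuter_X_zero, toOuter_X_one]
    simpa using isUnit_single_one
  refine ⟨hV.unit, Units.ext ?_⟩
  rw [hu, toIter_eq]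
  rfl

theorem innerVar_mem_regularUnits : (innerVar : (IterLaurent R)ˣ) ∈ regularUnits := by
  refine mem_regularUnits (v := 0) ?_
  rw [mul_zero, sub_zero, toIter_eq, toOuter_X_zero, HahnSeries.ofPowerSeries_C, val_innerVar,
    HahnSeries.C_apply]

end Residue

/-! ### The residue identity for a single monomial -/

section MonomialIdentity

variable {R : Type*} [CommRing R]

/-- Reduction of a linear functional on `R[[x, y]][x⁻¹, y⁻¹, (x - y)⁻¹]`, given by its values
`D a b c h` on the elements `h (x - y)ᵃ xᵇ yᶜ`. It vanishes as soon as it vanishes in the absence of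
a pole along `x = y` and on the elements `g(x) xᵇ (x - y)⁻ᵐ⁻¹`. The order of the pole along `x = y`
is lowered with the help of `1 / y = 1 / x + (x - y) / (x y)` and
`h(x, y) = h(x, x) + (x - y) h'(x, y)`. -/
theorem eq_zero_of_pole_reduction {N : Type*} [AddCommGroup N]
    (D : ℤ → ℤ → ℤ → MvPowerSeries (Fin 2) R →+ N)
    (hsub : ∀ a b c h, D a b c ((X 0 - X 1) * h) = D (a + 1) b c h)
    (hx : ∀ a b c h, D a b c (X 0 * h) = D a (b + 1) c h)
    (hy : ∀ a b c h, D a b c (X 1 * h) = D a b (c + 1) h)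
    (hreg : ∀ b c h, D 0 b c h = 0)
    (hpole : ∀ (m : ℕ) b g, D (-(m + 1 : ℕ)) b 0 (PowerSeries.toMvPowerSeries 0 g) = 0)
    (a b c : ℤ) (h : MvPowerSeries (Fin 2) R) : D a b c h = 0 := by
  have hneg : ∀ (m : ℕ) b c h, D (-(m : ℕ)) b c h = 0 := by
    intro m
    induction m with
    | zero => simpa using hreg
    | succ m ih =>
      have ih' : ∀ b c h, D (-((m + 1 : ℕ) : ℤ) + 1) b c h = 0 := by
        intro b c h
        rw [← ih b c h]
        congr 3
        push_cast
        ring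
      have hzero : ∀ b h, D (-((m + 1 : ℕ) : ℤ)) b 0 h = 0 := by
        intro b h
        obtain ⟨g, h', hh⟩ := exists_eq_add_sub_mul h
        rw [hh, map_add, hpole, hsub, ih', add_zero]
      have hpos : ∀ (k : ℕ) b h, D (-((m + 1 : ℕ) : ℤ)) b k h = 0 := by
        intro k
        induction k with
        | zero => simpa using hzero
        | succ k ihk =>
          intro b h
          have := ihk b (X 1 * h)
          rw [hy] at this
          exact_mod_cast this
      intro b c
      induction c using Int.induction_on generalizing b with
      | zero => exact hzero b
      | succ k => exact_mod_cast hpos (k + 1) b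
      | pred k ihk =>
        intro h
        have e : (X 0 : MvPowerSeries (Fin 2) R) * h = X 1 * h + (X 0 - X 1) * h := by ring
        have := congrArg (D (-((m + 1 : ℕ) : ℤ)) (b - 1) (-(k : ℤ) - 1)) e
        rwa [map_add, hx, hy, hsub, ih', add_zero, sub_add_cancel, sub_add_cancel, ihk] at this
  rcases le_total a 0 with ha | ha
  · obtain ⟨m, rfl⟩ := Int.eq_ofNat_of_zero_le (neg_nonneg.2 ha) |>.imp fun m hm =>
      (neg_eq_iff_eq_neg.1 hm)
    exact hneg m b c h
  · obtain ⟨m, rfl⟩ := Int.eq_ofNat_of_zero_le ha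
    induction m generalizing h with
    | zero => exact hreg b c h
    | succ m ih =>
      have := ih ((X 0 - X 1) * h) (Int.natCast_nonneg m)
      rw [hsub] at this
      exact_mod_cast this

/-- The residue of `J φ(h) u₀ᵃ u₁ᵇ u₂ᶜ` as an additive function of `h`. -/
def monomialRes (φ : MvPowerSeries (Fin 2) R →+* IterLaurent R) (J : IterLaurent R)
    (u₀ u₁ u₂ : (IterLaurent R)ˣ) (a b c : ℤ) : MvPowerSeries (Fin 2) R →+ R :=
  (iterRes.comp (AddMonoidHom.mulLeft (J * ((u₀ ^ a * u₁ ^ b * u₂ ^ c : (IterLaurent R)ˣ) :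
    IterLaurent R)))).comp φ.toAddMonoidHom

variable {φ : MvPowerSeries (Fin 2) R →+* IterLaurent R} {J : IterLaurent R}
  {u₀ u₁ u₂ : (IterLaurent R)ˣ}

theorem monomialRes_apply (a b c : ℤ) (h : MvPowerSeries (Fin 2) R) :
    monomialRes φ J u₀ u₁ u₂ a b c h =
      iterRes (J * ((u₀ ^ a * u₁ ^ b * u₂ ^ c : (IterLaurent R)ˣ) : IterLaurent R) * φ h) := rfl

theorem monomialRes_mul₀ {p : MvPowerSeries (Fin 2) R} (hp : φ p = u₀) (a b c : ℤ)
    (h : MvPowerSeries (Fin 2) R) :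
    monomialRes φ J u₀ u₁ u₂ a b c (p * h) = monomialRes φ J u₀ u₁ u₂ (a + 1) b c h := by
  rw [monomialRes_apply, monomialRes_apply, map_mul φ, hp, zpow_add_one]
  simp only [Units.val_mul]
  refine congrArg iterRes ?_
  ring

theorem monomialRes_mul₁ {p : MvPowerSeries (Fin 2) R} (hp : φ p = u₁) (a b c : ℤ)
    (h : MvPowerSeries (Fin 2) R) :
    monomialRes φ J u₀ u₁ u₂ a b c (p * h) = monomialRes φ J u₀ u₁ u₂ a (b + 1) c h := by
  rw [monomialRes_apply, monomialRes_apply, map_mul φ, hp, zpow_add_one]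
  simp only [Units.val_mul]
  refine congrArg iterRes ?_
  ring

theorem monomialRes_mul₂ {p : MvPowerSeries (Fin 2) R} (hp : φ p = u₂) (a b c : ℤ)
    (h : MvPowerSeries (Fin 2) R) :
    monomialRes φ J u₀ u₁ u₂ a b c (p * h) = monomialRes φ J u₀ u₁ u₂ a b (c + 1) h := by
  rw [monomialRes_apply, monomialRes_apply, map_mul φ, hp, zpow_add_one]
  simp only [Units.val_mul]
  refine congrArg iterRes ?_
  ring

theorem monomialRes_eq_zero (hJ : J ∈ (HahnSeries.ofPowerSeries ℤ (LaurentSeries R)).range)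
    (hφ : ∀ h, φ h ∈ (HahnSeries.ofPowerSeries ℤ (LaurentSeries R)).range) {a b c : ℤ}
    (h₀ : u₀ ^ a ∈ regularUnits) (h₁ : u₁ ^ b ∈ regularUnits) (h₂ : u₂ ^ c ∈ regularUnits)
    (h : MvPowerSeries (Fin 2) R) : monomialRes φ J u₀ u₁ u₂ a b c h = 0 :=
  iterRes_eq_zero (mul_mem (mul_mem hJ (val_mem_range (mul_mem (mul_mem h₀ h₁) h₂))) (hφ h))

theorem val_subInnerOuter : ((subInnerOuter : (IterLaurent R)ˣ) : IterLaurent R) =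
    toIter (X 0 - X 1) := rfl

theorem val_subOuterInner : ((subOuterInner : (IterLaurent R)ˣ) : IterLaurent R) =
    toIter (X 1 - X 0) := rfl

theorem val_innerVar_eq : ((innerVar : (IterLaurent R)ˣ) : IterLaurent R) = toIter (X 0) := by
  rw [toIter_eq, toOuter_X_zero, HahnSeries.ofPowerSeries_C, val_innerVar, HahnSeries.C_apply]

theorem val_outerVar_eq : ((outerVar : (IterLaurent R)ˣ) : IterLaurent R) = toIter (X 1) := by
  rw [toIter_eq, toOuter_X_one, HahnSeries.ofPowerSeries_X, val_outerVar]

/-- The expansion `- ∑ x⁻¹⁻ʲ yʲ` of `(y - x)⁻¹` in `R((x))[[y]]`. -/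
def geomSeries : PowerSeries (LaurentSeries R) :=
  PowerSeries.mk fun j => HahnSeries.single (-1 - (j : ℤ)) (-1)

theorem X_sub_mul_geomSeries :
    (PowerSeries.X - PowerSeries.C (HahnSeries.single 1 1)) * (geomSeries (R := R)) = 1 := by
  ext j : 1
  rw [sub_mul, map_sub, PowerSeries.coeff_C_mul]
  cases j with
  | zero =>
    rw [PowerSeries.coeff_zero_X_mul, geomSeries, PowerSeries.coeff_mk,
      HahnSeries.single_mul_single, PowerSeries.coeff_one]
    simp
  | succ j =>
    rw [PowerSeries.coeff_succ_X_mul, geomSeries, PowerSeries.coeff_mk, PowerSeries.coeff_mk,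
      HahnSeries.single_mul_single, PowerSeries.coeff_one, one_mul,
      show (1 : ℤ) + (-1 - ((j + 1 : ℕ) : ℤ)) = -1 - (j : ℤ) by push_cast; ring, sub_self,
      if_neg (Nat.succ_ne_zero j)]

/-- `(y - x)⁻ⁿ` is homogeneous of degree `-n`. -/
theorem exists_coeff_geomSeries_pow (n j : ℕ) : ∃ r : R,
    PowerSeries.coeff j (geomSeries ^ n) = HahnSeries.single (-(n : ℤ) - j) r := by
  induction n generalizing j with
  | zero =>
    by_cases hj : j = 0
    · exact ⟨1, by subst hj; simp⟩
    · exact ⟨0, by simp [PowerSeries.coeff_one, hj]⟩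
  | succ n ih =>
    choose r hr using ih
    refine ⟨∑ p ∈ Finset.HasAntidiagonal.antidiagonal j, r p.1 * -1, ?_⟩
    rw [pow_succ, PowerSeries.coeff_mul]
    refine Eq.trans (Finset.sum_congr rfl fun p hp => ?_) (map_sum
      (HahnSeries.single.addMonoidHom (-((n + 1 : ℕ) : ℤ) - (j : ℤ)))
      (fun p : ℕ × ℕ => r p.1 * -1) _).symm
    rw [hr, geomSeries, PowerSeries.coeff_mk, HahnSeries.single_mul_single]
    have hpj := Finset.HasAntidiagonal.mem_antidiagonal.1 hp
    change _ = HahnSeries.single (-((n + 1 : ℕ) : ℤ) - (j : ℤ)) (r p.1 * -1)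
    refine congrArg (fun d : ℤ => HahnSeries.single d (r p.1 * -1)) ?_
    rw [← hpj]
    push_cast
    ring

theorem coeff_coeff_geomSeries_pow (m j : ℕ) :
    (PowerSeries.coeff j (geomSeries (R := R) ^ (m + 1))).coeff (-1) =
      if m = 0 ∧ j = 0 then -1 else 0 := by
  split_ifs with h
  · obtain ⟨rfl, rfl⟩ := h
    simp [geomSeries]
  · obtain ⟨r, hr⟩ := exists_coeff_geomSeries_pow (R := R) (m + 1) j
    rw [hr, HahnSeries.coeff_single_of_ne]
    push_cast
    omega

theorem val_subOuterInner_zpow (m : ℕ) :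
    ((subOuterInner ^ (-(m + 1 : ℕ) : ℤ) : (IterLaurent R)ˣ) : IterLaurent R) =
      HahnSeries.ofPowerSeries ℤ (LaurentSeries R) (geomSeries ^ (m + 1)) := by
  have h : ((subOuterInner⁻¹ : (IterLaurent R)ˣ) : IterLaurent R) =
      HahnSeries.ofPowerSeries ℤ (LaurentSeries R) geomSeries := by
    refine Units.inv_eq_of_mul_eq_one_right ?_
    rw [val_subOuterInner, toIter_eq, ← map_mul, map_sub, toOuter_X_zero, toOuter_X_one,
      X_sub_mul_geomSeries, map_one]
  rw [zpow_neg, ← inv_zpow, zpow_natCast, Units.val_pow_eq_pow_val, h, map_pow]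

/-- With the roles of the variables exchanged, `g(y) yᵇ (y - x)⁻ᵐ⁻¹` is expanded in powers of
`y / x`; for reasons of degree, the residue in `x` only sees the term `- 1 / x` for `m = 0`. -/
theorem monomialRes_swap_pole (m : ℕ) (b : ℤ) (g : PowerSeries R) :
    monomialRes (toIterHom.comp (swapVars (R := R)).toRingHom) 1 subOuterInner outerVar innerVar
      (-(m + 1 : ℕ)) b 0 (g.toMvPowerSeries 0) =
      if m = 0 then -(HahnSeries.ofPowerSeries ℤ R g).coeff (-1 - b) else 0 := by
  have hsw : swapVars (g.toMvPowerSeries 0) = g.toMvPowerSeries 1 := by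
    rw [swapVars, rename_toMvPowerSeries, Equiv.swap_apply_left]
  have e : (1 : IterLaurent R) * ((subOuterInner ^ (-(m + 1 : ℕ) : ℤ) * outerVar ^ b *
      innerVar ^ (0 : ℤ) : (IterLaurent R)ˣ) : IterLaurent R) *
      (toIterHom.comp (swapVars (R := R)).toRingHom) (g.toMvPowerSeries 0) =
      HahnSeries.ofPowerSeries ℤ (LaurentSeries R)
        (PowerSeries.map HahnSeries.C g * geomSeries ^ (m + 1)) *
      ((outerVar ^ b : (IterLaurent R)ˣ) : IterLaurent R) := by
    have : (toIterHom.comp (swapVars (R := R)).toRingHom) (g.toMvPowerSeries 0) =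
        HahnSeries.ofPowerSeries ℤ (LaurentSeries R) (PowerSeries.map HahnSeries.C g) := by
      rw [← toOuter_toMvPowerSeries_one, ← hsw]
      rfl
    rw [this, zpow_zero, mul_one, Units.val_mul, val_subOuterInner_zpow, map_mul]
    ring
  rw [monomialRes_apply, e, iterRes_apply, iterCoeff_mul_outerVar_zpow, iterCoeff,
    coeff_ofPowerSeries, coeff_ofPowerSeries]
  by_cases hb : -1 - b < 0
  · simp [hb]
  · rw [if_neg hb, if_neg hb, PowerSeries.coeff_mul]
    have : ∀ s : Finset (ℕ × ℕ), (∑ p ∈ s, PowerSeries.coeff p.1 (PowerSeries.map HahnSeries.C g) *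
        PowerSeries.coeff p.2 (geomSeries (R := R) ^ (m + 1))).coeff (-1) =
        ∑ p ∈ s, PowerSeries.coeff p.1 g * if m = 0 ∧ p.2 = 0 then -1 else 0 := by
      intro s
      rw [← HahnSeries.coeff.addMonoidHom_apply, map_sum]
      refine Finset.sum_congr rfl fun p _ => ?_
      rw [HahnSeries.coeff.addMonoidHom_apply, PowerSeries.coeff_map, HahnSeries.C_mul_eq_smul,
        HahnSeries.coeff_smul, smul_eq_mul, coeff_coeff_geomSeries_pow]
    rw [this]
    split_ifs with hm
    · rw [Finset.sum_eq_single ((-1 - b).natAbs, 0)]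
      · simp [hm]
      · intro p hp hne
        have hpj := Finset.HasAntidiagonal.mem_antidiagonal.1 hp
        rw [if_neg, mul_zero]
        rintro ⟨-, h2⟩
        exact hne (Prod.ext (by simpa [h2] using hpj) h2)
      · intro h
        simp at h
    · simp [hm]

/-- The residue of `g(x) xᵇ t⁻ᵐ⁻¹ dt` for `t = x - Φ(x, y) = y v(x, y)` with `v` invertible. -/
theorem monomialRes_subst_pole {v : (MvPowerSeries (Fin 2) R)ˣ}
    {Φ : MvPowerSeries (Fin 2) R} (hΦ : X 0 - Φ = X 1 * (v : MvPowerSeries (Fin 2) R))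
    {t q : (IterLaurent R)ˣ} (ht : (t : IterLaurent R) = toIter (X 0 - Φ))
    (hs : MvPowerSeries.HasSubst ![X 0, Φ])
    (m : ℕ) (b : ℤ) (g : PowerSeries R) :
    monomialRes (toIterHom.comp (substAlgHom (R := R) hs).toRingHom)
      (toIter (pderiv R 1 (X 0 - Φ))) t innerVar q
      (-(m + 1 : ℕ)) b 0 (g.toMvPowerSeries 0) =
      if m = 0 then (HahnSeries.ofPowerSeries ℤ R g).coeff (-1 - b) else 0 := by
  let V : (PowerSeries (LaurentSeries R))ˣ := Units.map (toOuter (R := R)).toMonoidHom v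
  have htV : t = outerVar * Units.map
      (HahnSeries.ofPowerSeries ℤ (LaurentSeries R)).toMonoidHom V := by
    ext1
    rw [Units.val_mul, ht, hΦ, val_outerVar_eq, toIter_eq, toIter_eq, map_mul, map_mul]
    rfl
  have htm : ((t ^ (-(m + 1 : ℕ) : ℤ) : (IterLaurent R)ˣ) : IterLaurent R) =
      HahnSeries.ofPowerSeries ℤ (LaurentSeries R)
        ((V⁻¹ ^ (m + 1) : (PowerSeries (LaurentSeries R))ˣ) : PowerSeries (LaurentSeries R)) *
      ((outerVar ^ (-(m + 1 : ℕ) : ℤ) : (IterLaurent R)ˣ) : IterLaurent R) := by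
    have h1 := map_pow (Units.map (HahnSeries.ofPowerSeries ℤ (LaurentSeries R)).toMonoidHom)
      V⁻¹ (m + 1)
    have h2 := mul_zpow outerVar (Units.map
      (HahnSeries.ofPowerSeries ℤ (LaurentSeries R)).toMonoidHom V) (-(m + 1 : ℕ) : ℤ)
    rw [htV, h2, mul_comm, Units.val_mul]
    congr 2
    rw [zpow_neg, ← inv_zpow, zpow_natCast, ← map_inv, ← h1]
    rfl
  have hJ : toIter (pderiv R 1 (X 0 - Φ)) =
      HahnSeries.ofPowerSeries ℤ (LaurentSeries R) (PowerSeries.derivative _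
        (PowerSeries.X * (V : PowerSeries (LaurentSeries R)))) := by
    rw [hΦ, toIter_eq, toOuter_pderiv, map_mul, toOuter_X_one]
    rfl
  have hg : (toIterHom.comp (substAlgHom (R := R) hs).toRingHom) (g.toMvPowerSeries 0) =
      HahnSeries.C (HahnSeries.ofPowerSeries ℤ R g) := by
    have h1 : substAlgHom (R := R) hs (g.toMvPowerSeries 0) = g.toMvPowerSeries 0 := by
      rw [substAlgHom_apply, PowerSeries.subst_toMvPowerSeries hs,
        PowerSeries.toMvPowerSeries_eq_subst]
      rfl
    change toIterHom (substAlgHom (R := R) hs (g.toMvPowerSeries 0)) = _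
    rw [h1, toIterHom_apply, toIter_eq, toOuter_toMvPowerSeries_zero, HahnSeries.ofPowerSeries_C]
  have e : toIter (pderiv R 1 (X 0 - Φ)) *
      ((t ^ (-(m + 1 : ℕ) : ℤ) * innerVar ^ b * q ^ (0 : ℤ) : (IterLaurent R)ˣ) : IterLaurent R) *
      (toIterHom.comp (substAlgHom (R := R) hs).toRingHom) (g.toMvPowerSeries 0) =
      HahnSeries.C (HahnSeries.ofPowerSeries ℤ R g) *
        (HahnSeries.ofPowerSeries ℤ (LaurentSeries R)
          (((V⁻¹ ^ (m + 1) : (PowerSeries (LaurentSeries R))ˣ) : PowerSeries (LaurentSeries R)) *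
            PowerSeries.derivative _ (PowerSeries.X * (V : PowerSeries (LaurentSeries R)))) *
        ((outerVar ^ (-(m + 1 : ℕ) : ℤ) : (IterLaurent R)ˣ) : IterLaurent R)) *
      ((innerVar ^ b : (IterLaurent R)ˣ) : IterLaurent R) := by
    rw [hg, hJ, zpow_zero, mul_one, Units.val_mul, htm, map_mul (HahnSeries.ofPowerSeries ℤ _)]
    ring
  rw [monomialRes_apply, e, iterRes_apply, iterCoeff_mul_innerVar_zpow, iterCoeff_C_mul]
  have h2 : (HahnSeries.ofPowerSeries ℤ (LaurentSeries R)
      (((V⁻¹ ^ (m + 1) : (PowerSeries (LaurentSeries R))ˣ) : PowerSeries (LaurentSeries R)) *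
        PowerSeries.derivative _ (PowerSeries.X * (V : PowerSeries (LaurentSeries R)))) *
      ((outerVar ^ (-(m + 1 : ℕ) : ℤ) : (IterLaurent R)ˣ) : IterLaurent R)).coeff (-1) =
      if m = 0 then 1 else 0 := by
    rw [← coeff_inv_pow_mul_derivative V m]
    ext k
    have := iterCoeff_mul_outerVar_zpow (HahnSeries.ofPowerSeries ℤ (LaurentSeries R)
      (((V⁻¹ ^ (m + 1) : (PowerSeries (LaurentSeries R))ˣ) : PowerSeries (LaurentSeries R)) *
        PowerSeries.derivative _ (PowerSeries.X * (V : PowerSeries (LaurentSeries R)))))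
      (-(m + 1 : ℕ) : ℤ) k (-1)
    rw [iterCoeff, iterCoeff, coeff_ofPowerSeries,
      show (-1 - -((m + 1 : ℕ) : ℤ)) = m by push_cast; ring,
      if_neg (by omega), Int.natAbs_natCast] at this
    exact this
  rw [h2]
  split_ifs <;> simp

/-- The residue identity for `h(x₁, x₂) (x₁ - x₂)ᵃ x₁ᵇ x₂ᶜ`, where the third residue is taken in
the coordinate `x₀` with `x₂ = Φ(x₁, x₀)` and `x₁ - x₂ = x₀ v(x₁, x₀)`, `v` invertible. -/
theorem monomialRes_sub_monomialRes {v : (MvPowerSeries (Fin 2) R)ˣ}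
    {Φ : MvPowerSeries (Fin 2) R} (hΦ : X 0 - Φ = X 1 * (v : MvPowerSeries (Fin 2) R))
    {t q : (IterLaurent R)ˣ} (ht : (t : IterLaurent R) = toIter (X 0 - Φ))
    (hq : (q : IterLaurent R) = toIter Φ)
    (hs : MvPowerSeries.HasSubst ![X 0, Φ])
    (a b c : ℤ) (h : MvPowerSeries (Fin 2) R) :
    monomialRes toIterHom 1 subInnerOuter innerVar outerVar a b c h -
      monomialRes (toIterHom.comp (swapVars (R := R)).toRingHom) 1
        subOuterInner outerVar innerVar a b c h =
      monomialRes (toIterHom.comp (substAlgHom (R := R) hs).toRingHom)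
        (toIter (pderiv R 1 (X 0 - Φ))) t innerVar q a b c h := by
  have hA0 : toIterHom (X 0 : MvPowerSeries (Fin 2) R) =
      ((innerVar : (IterLaurent R)ˣ) : IterLaurent R) := by
    rw [toIterHom_apply, val_innerVar_eq]
  have hA1 : toIterHom (X 1 : MvPowerSeries (Fin 2) R) =
      ((outerVar : (IterLaurent R)ˣ) : IterLaurent R) := by
    rw [toIterHom_apply, val_outerVar_eq]
  have hAs : toIterHom (X 0 - X 1 : MvPowerSeries (Fin 2) R) =
      ((subInnerOuter : (IterLaurent R)ˣ) : IterLaurent R) := toIterHom_apply _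
  have hB0 : (toIterHom.comp (swapVars (R := R)).toRingHom) (X 0) =
      ((outerVar : (IterLaurent R)ˣ) : IterLaurent R) := by
    rw [← hA1, ← swapVars_X_zero]
    rfl
  have hB1 : (toIterHom.comp (swapVars (R := R)).toRingHom) (X 1) =
      ((innerVar : (IterLaurent R)ˣ) : IterLaurent R) := by
    rw [← hA0, ← swapVars_X_one]
    rfl
  have hBs : (toIterHom.comp (swapVars (R := R)).toRingHom) (X 0 - X 1) =
      ((subOuterInner : (IterLaurent R)ˣ) : IterLaurent R) := by
    rw [map_sub, hB0, hB1, val_subOuterInner, ← toIterHom_apply, map_sub, hA0, hA1]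
  have hC0 : (toIterHom.comp (substAlgHom (R := R) hs).toRingHom) (X 0) =
      ((innerVar : (IterLaurent R)ˣ) : IterLaurent R) := by
    change toIterHom (substAlgHom (R := R) hs (X 0)) = _
    rw [substAlgHom_X, ← hA0]
    rfl
  have hC1 : (toIterHom.comp (substAlgHom (R := R) hs).toRingHom) (X 1) = q := by
    change toIterHom (substAlgHom (R := R) hs (X 1)) = _
    rw [substAlgHom_X, hq, ← toIterHom_apply]
    rfl
  have hCs : (toIterHom.comp (substAlgHom (R := R) hs).toRingHom) (X 0 - X 1) = t := by
    rw [map_sub, hC0, hC1, hq, ht, ← hA0, ← toIterHom_apply, ← toIterHom_apply, ← map_sub]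
  have hAr : ∀ h, toIterHom (R := R) h ∈ (HahnSeries.ofPowerSeries ℤ (LaurentSeries R)).range :=
    fun h => ⟨toOuter h, rfl⟩
  have hCr : ∀ h, (toIterHom.comp (substAlgHom (R := R) hs).toRingHom) h ∈
      (HahnSeries.ofPowerSeries ℤ (LaurentSeries R)).range := fun h => hAr _
  have hin := innerVar_mem_regularUnits (R := R)
  have hsub : (subInnerOuter : (IterLaurent R)ˣ) ∈ regularUnits :=
    mem_regularUnits (v := 1) (by rw [mul_one, val_subInnerOuter])
  have hqr : q ∈ regularUnits :=
    mem_regularUnits (v := v) (by rw [hq, ← hΦ, sub_sub_cancel])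
  rw [← sub_eq_zero]
  refine eq_zero_of_pole_reduction (fun a b c =>
    monomialRes toIterHom 1 subInnerOuter innerVar outerVar a b c -
      monomialRes (toIterHom.comp (swapVars (R := R)).toRingHom) 1
        subOuterInner outerVar innerVar a b c -
      monomialRes (toIterHom.comp (substAlgHom (R := R) hs).toRingHom)
        (toIter (pderiv R 1 (X 0 - Φ))) t innerVar q a b c)
    ?_ ?_ ?_ ?_ ?_ a b c h
  · intro a b c h
    simp only [AddMonoidHom.sub_apply]
    rw [monomialRes_mul₀ hAs, monomialRes_mul₀ hBs, monomialRes_mul₀ hCs]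
  · intro a b c h
    simp only [AddMonoidHom.sub_apply]
    rw [monomialRes_mul₁ hA0, monomialRes_mul₁ hB0, monomialRes_mul₁ hC0]
  · intro a b c h
    simp only [AddMonoidHom.sub_apply]
    rw [monomialRes_mul₂ hA1, monomialRes_mul₂ hB1, monomialRes_mul₂ hC1]
  · intro b c h
    simp only [AddMonoidHom.sub_apply]
    rw [monomialRes_eq_zero (toIter_mem_range _) hCr (by simp) (zpow_mem hin b)
      (zpow_mem hqr c), sub_zero, sub_eq_zero, monomialRes_apply,
      monomialRes_apply, one_mul, one_mul, zpow_zero, zpow_zero, one_mul, one_mul]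
    have e1 : ((innerVar ^ b * outerVar ^ c : (IterLaurent R)ˣ) : IterLaurent R) * toIterHom h =
        toIter h * ((innerVar ^ b : (IterLaurent R)ˣ) : IterLaurent R) *
          ((outerVar ^ c : (IterLaurent R)ˣ) : IterLaurent R) := by
      rw [Units.val_mul, toIterHom_apply]
      ring
    have e2 : ((outerVar ^ b * innerVar ^ c : (IterLaurent R)ˣ) : IterLaurent R) *
        (toIterHom.comp (swapVars (R := R)).toRingHom) h =
        toIter (swapVars h) * ((innerVar ^ c : (IterLaurent R)ˣ) : IterLaurent R) *
          ((outerVar ^ b : (IterLaurent R)ˣ) : IterLaurent R) := by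
      rw [Units.val_mul, ← toIterHom_apply]
      change _ * toIterHom (swapVars h) = _
      ring
    rw [e1, e2, iterRes_apply, iterRes_apply, iterCoeff_mul_outerVar_zpow,
      iterCoeff_mul_outerVar_zpow, iterCoeff_mul_innerVar_zpow, iterCoeff_mul_innerVar_zpow,
      iterCoeff_toIter_swapVars]
  · intro m b g
    simp only [AddMonoidHom.sub_apply]
    rw [monomialRes_eq_zero (one_mem _) hAr (zpow_mem hsub _) (zpow_mem hin b) (by simp),
      monomialRes_swap_pole, monomialRes_subst_pole hΦ ht hs]
    split_ifs <;> simp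

end MonomialIdentity

/-! ### Summation over the monomials of the bilateral series -/

section Summation

variable {R : Type*} [CommRing R]

theorem exists_ne_zero_of_finsum_ne_zero {ι : Type*} {α : ι → R} (h : ∑ᶠ e, α e ≠ 0) :
    ∃ e, α e ≠ 0 := by
  by_contra! h0
  exact h (finsum_eq_zero_of_forall_eq_zero h0)

theorem finsum_sub_eq_finsum {ι : Type*} {α β γ : ι → R} (hα : (Function.support α).Finite)
    (hβ : (Function.support β).Finite) (h : ∀ e, α e - β e = γ e) :
    ∑ᶠ e, α e - ∑ᶠ e, β e = ∑ᶠ e, γ e := by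
  rw [← finsum_sub_distrib hα hβ]
  exact finsum_congr h

theorem iterCoeff_smul (r : R) (g : IterLaurent R) (m n : ℤ) :
    iterCoeff (r • g) m n = r * iterCoeff g m n := by
  simp [iterCoeff]

theorem smul_eq_C_C_mul (r : R) (g : IterLaurent R) :
    r • g = HahnSeries.C (HahnSeries.C r) * g := by
  ext n : 2
  rw [HahnSeries.C_mul_eq_smul, HahnSeries.coeff_smul, HahnSeries.coeff_smul, smul_eq_mul,
    HahnSeries.C_mul_eq_smul]

theorem val_mul_zpow (u v : (IterLaurent R)ˣ) (n : ℤ) :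
    (((u * v) ^ n : (IterLaurent R)ˣ) : IterLaurent R) =
      ((u ^ n : (IterLaurent R)ˣ) : IterLaurent R) * ((v ^ n : (IterLaurent R)ˣ) : IterLaurent R) :=
  congrArg Units.val (mul_zpow u v n)

theorem iterCoeff_substTerm (f : (Fin 3 → ℤ) → R) (u₀ u₁ u₂ : (IterLaurent R)ˣ) (e : Fin 3 → ℤ)
    (m n : ℤ) : iterCoeff (substTerm f ![u₀, u₁, u₂] e) m n =
      f e * iterCoeff
        ((u₀ ^ e 0 * u₁ ^ e 1 * u₂ ^ e 2 : (IterLaurent R)ˣ) : IterLaurent R) m n := by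
  rw [substTerm, iterCoeff_smul, Fin.prod_univ_three]
  rfl

section LaurentProduct

variable {A : Type*} [CommRing A]

theorem laurent_mul_support_subset (s g : LaurentSeries A) (n : ℤ) :
    Function.support (fun i => s.coeff i * g.coeff (n - i)) ⊆
      ((Finset.antidiagonal s.isPWO_support g.isPWO_support n).image Prod.fst : Finset ℤ) := by
  intro i hi
  have h1 : s.coeff i ≠ 0 := fun h => hi (by simp [h])
  have h2 : g.coeff (n - i) ≠ 0 := fun h => hi (by simp [h])
  simp only [Finset.coe_image, Set.mem_image, Finset.mem_coe, Finset.mem_antidiagonal]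
  exact ⟨(i, n - i), ⟨h1, h2, by ring⟩, rfl⟩

theorem laurent_mul_support_finite (s g : LaurentSeries A) (n : ℤ) :
    (Function.support fun i => s.coeff i * g.coeff (n - i)).Finite :=
  (Finset.finite_toSet _).subset (laurent_mul_support_subset s g n)

theorem laurent_coeff_mul (s g : LaurentSeries A) (n : ℤ) :
    (s * g).coeff n = ∑ᶠ i, s.coeff i * g.coeff (n - i) := by
  rw [finsum_eq_sum_of_support_subset _ (laurent_mul_support_subset s g n), Finset.sum_image]
  · rw [HahnSeries.coeff_mul]
    refine Finset.sum_congr rfl fun p hp => ?_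
    rw [← (Finset.mem_antidiagonal.1 hp).2.2, add_sub_cancel_left]
  · intro p hp q hq hpq
    have h1 := (Finset.mem_antidiagonal.1 hp).2.2
    have h2 := (Finset.mem_antidiagonal.1 hq).2.2
    exact Prod.ext hpq (by linear_combination h1 - h2 - hpq)

end LaurentProduct

theorem iterCoeff_toMvPowerSeries_mul (p : PowerSeries R) (g : IterLaurent R) (m n : ℤ) :
    iterCoeff (toIter (p.toMvPowerSeries 0 * p.toMvPowerSeries 1) * g) m n =
      ∑ᶠ i, (HahnSeries.ofPowerSeries ℤ R p).coeff i *
        ∑ᶠ j, (HahnSeries.ofPowerSeries ℤ R p).coeff j * iterCoeff g (m - i) (n - j) := by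
  have hcoeff : ∀ j, (HahnSeries.ofPowerSeries ℤ (LaurentSeries R)
      (PowerSeries.map HahnSeries.C p)).coeff j =
      HahnSeries.C ((HahnSeries.ofPowerSeries ℤ R p).coeff j) := by
    intro j
    rw [coeff_ofPowerSeries, coeff_ofPowerSeries]
    split_ifs
    · rw [map_zero]
    · rw [PowerSeries.coeff_map]
  rw [toIter_eq, map_mul, map_mul, toOuter_toMvPowerSeries_zero, toOuter_toMvPowerSeries_one,
    HahnSeries.ofPowerSeries_C, mul_assoc, iterCoeff_C_mul, laurent_coeff_mul]
  refine finsum_congr fun i => ?_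
  congr 1
  rw [laurent_coeff_mul, ← HahnSeries.coeff.addMonoidHom_apply,
    AddMonoidHom.map_finsum _ (laurent_mul_support_finite _ _ n)]
  refine finsum_congr fun j => ?_
  rw [HahnSeries.coeff.addMonoidHom_apply, hcoeff, HahnSeries.C_mul_eq_smul,
    HahnSeries.coeff_smul, smul_eq_mul, iterCoeff]

/-- Under the convergence hypothesis, the two `F`-residues may be taken monomial by monomial, and
amount to the iterated residue of the product with `p_F(x) p_F(y)`. -/
theorem fResidue_fResidue_substitute {F : FormalGroup R} {f : (Fin 3 → ℤ) → R}
    {u₀ u₁ u₂ : (IterLaurent R)ˣ} (h : FSubstConverges F f ![u₀, u₁, u₂]) :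
    fResidue F (fun m => fResidue F fun n => substitute f ![u₀, u₁, u₂] m n) =
      ∑ᶠ e : Fin 3 → ℤ, f e * iterRes (toIter ((invDiff F).toMvPowerSeries 0 *
        (invDiff F).toMvPowerSeries 1) *
          ((u₀ ^ e 0 * u₁ ^ e 1 * u₂ ^ e 2 : (IterLaurent R)ˣ) : IterLaurent R)) ∧
    (Function.support fun e : Fin 3 → ℤ => f e * iterRes (toIter ((invDiff F).toMvPowerSeries 0 *
        (invDiff F).toMvPowerSeries 1) *
          ((u₀ ^ e 0 * u₁ ^ e 1 * u₂ ^ e 2 : (IterLaurent R)ˣ) : IterLaurent R))).Finite := by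
  set u : Fin 3 → (IterLaurent R)ˣ := ![u₀, u₁, u₂] with hu
  let p := invDiffCoeff F
  let c : (Fin 3 → ℤ) → ℤ → ℤ → R := fun e m n => iterCoeff (substTerm f u e) m n
  have hp0 : p 0 = 1 := by
    simp only [p]
    rw [invDiffCoeff, coeff_ofPowerSeries, if_neg (lt_irrefl _)]
    simp [constantCoeff_invDiff]
  -- the convergence hypothesis without the first factor `p`
  have hfin : ∀ m n, {t : (Fin 3 → ℤ) × ℤ | p t.2 * c t.1 m (n - t.2) ≠ 0}.Finite := by
    intro m n
    refine ((h m n).preimage (f := fun t : (Fin 3 → ℤ) × ℤ => (t.1, (0 : ℤ), t.2)) ?_).subset ?_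
    · intro s _ t _ hst
      exact Prod.ext (Prod.ext_iff.1 hst).1 (Prod.ext_iff.1 (Prod.ext_iff.1 hst).2).2
    · intro t ht
      simp only [Set.mem_preimage, Set.mem_ofPred_eq, sub_zero]
      rw [show invDiffCoeff F 0 = 1 from hp0, one_mul]
      exact ht
  have hfinj : ∀ e m n, (Function.support fun j => p j * c e m (n - j)).Finite := fun e m n =>
    ((hfin m n).preimage (f := fun j => (e, j)) fun _ _ _ _ h => (Prod.ext_iff.1 h).2).subset
      fun _ hj => hj
  have hfine : ∀ j m n, (Function.support fun e => p j * c e m (n - j)).Finite := fun j m n =>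
    ((hfin m n).preimage (f := fun e => (e, j)) fun _ _ _ _ h => (Prod.ext_iff.1 h).1).subset
      fun _ hj => hj
  have hfinc : ∀ m n, (Function.support fun e => c e m n).Finite :=
    fun m n => h.substConverges m n
  have hfins : ∀ m n, (Function.support fun j => ∑ᶠ e, p j * c e m (n - j)).Finite := by
    intro m n
    refine ((hfin m n).image Prod.snd).subset fun j hj => ?_
    obtain ⟨e, he⟩ := exists_ne_zero_of_finsum_ne_zero hj
    exact ⟨(e, j), he, rfl⟩
  let w : (Fin 3 → ℤ) × ℤ × ℤ → R := fun t =>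
    p t.2.1 * (p t.2.2 * c t.1 (-1 - t.2.1) (-1 - t.2.2))
  have hw : (Function.support w).Finite := h (-1) (-1)
  have hterm : ∀ e : Fin 3 → ℤ, f e * iterRes (toIter ((invDiff F).toMvPowerSeries 0 *
      (invDiff F).toMvPowerSeries 1) *
        ((u₀ ^ e 0 * u₁ ^ e 1 * u₂ ^ e 2 : (IterLaurent R)ˣ) : IterLaurent R)) =
      ∑ᶠ (i) (j), w (e, i, j) := by
    intro e
    rw [iterRes_apply, ← iterCoeff_smul, smul_eq_C_C_mul, mul_left_comm, ← smul_eq_C_C_mul]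
    have : f e • ((u₀ ^ e 0 * u₁ ^ e 1 * u₂ ^ e 2 : (IterLaurent R)ˣ) : IterLaurent R) =
        substTerm f u e := by
      rw [substTerm, Fin.prod_univ_three]
      rfl
    rw [this, iterCoeff_toMvPowerSeries_mul]
    refine finsum_congr fun i => ?_
    exact mul_finsum' _ _ (hfinj e (-1 - i) (-1))
  refine ⟨?_, ?_⟩
  · calc fResidue F (fun m => fResidue F fun n => substitute f u m n)
        = ∑ᶠ i, p i * ∑ᶠ j, p j * ∑ᶠ e, c e (-1 - i) (-1 - j) := rfl
      _ = ∑ᶠ (i) (j) (e), w (e, i, j) := by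
        refine finsum_congr fun i => ?_
        rw [finsum_congr fun j => mul_finsum' _ _ (hfinc (-1 - i) (-1 - j)),
          mul_finsum' _ _ (hfins (-1 - i) (-1))]
        exact finsum_congr fun j => mul_finsum' _ _ (hfine j (-1 - i) (-1))
      _ = ∑ᶠ t : ℤ × ℤ × (Fin 3 → ℤ), w (t.2.2, t.1, t.2.1) := by
        refine (finsum_curry₃ (fun t : ℤ × ℤ × (Fin 3 → ℤ) => w (t.2.2, t.1, t.2.1)) ?_).symm
        refine (hw.preimage (f := fun t : ℤ × ℤ × (Fin 3 → ℤ) => (t.2.2, t.1, t.2.1)) ?_).subset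
          fun _ ht => ht
        rintro ⟨i, j, e⟩ _ ⟨i', j', e'⟩ _ ht
        simp only [Prod.mk.injEq] at ht ⊢
        exact ⟨ht.2.1, ht.2.2, ht.1⟩
      _ = ∑ᶠ t, w t := finsum_comp_equiv
        (⟨fun t => (t.2.2, t.1, t.2.1), fun t => (t.2.1, t.2.2, t.1), fun _ => rfl, fun _ => rfl⟩ :
          ℤ × ℤ × (Fin 3 → ℤ) ≃ (Fin 3 → ℤ) × ℤ × ℤ) (f := w)
      _ = ∑ᶠ (e) (i) (j), w (e, i, j) := finsum_curry₃ w hw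
      _ = _ := finsum_congr fun e => (hterm e).symm
  · refine (hw.image Prod.fst).subset fun e he => ?_
    rw [Function.mem_support, hterm] at he
    obtain ⟨i, hi⟩ := exists_ne_zero_of_finsum_ne_zero he
    obtain ⟨j, hj⟩ := exists_ne_zero_of_finsum_ne_zero hi
    exact ⟨(e, i, j), hj, rfl⟩

end Summation

/-! ### The residue identities -/

section Identities

variable {R : Type*} [CommRing R]

/-- The residue identity for the monomial `z₀ᵃ z₁ᵇ z₂ᶜ` and the additive group law: here
`x₂ = x₁ - x₀`, so that `x₀` is the coordinate `x₁ - x₂` itself. -/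
theorem iterRes_monomial_additive (a b c : ℤ) :
    iterRes ((subInnerOuter ^ a * innerVar ^ b * outerVar ^ c : (IterLaurent R)ˣ) : IterLaurent R)
      - iterRes ((subOuterInner ^ a * outerVar ^ b * innerVar ^ c : (IterLaurent R)ˣ) :
        IterLaurent R) =
      iterRes ((outerVar ^ a * innerVar ^ b * subInnerOuter ^ c : (IterLaurent R)ˣ) :
        IterLaurent R) := by
  have hs : MvPowerSeries.HasSubst ![X 0, (X 0 - X 1 : MvPowerSeries (Fin 2) R)] :=
    hasSubst_pair (by simp) (by simp)
  have key := monomialRes_sub_monomialRes (R := R) (v := 1) (Φ := X 0 - X 1) (t := outerVar)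
    (q := subInnerOuter) (by rw [sub_sub_cancel, Units.val_one, mul_one])
    (by rw [sub_sub_cancel, val_outerVar_eq]) val_subInnerOuter hs a b c 1
  simp only [monomialRes_apply, map_one, mul_one, sub_sub_cancel, pderiv_X_self,
    ← toIterHom_apply, one_mul] at key
  exact key

theorem ringHom_val_zpow (φ : MvPowerSeries (Fin 2) R →+* IterLaurent R)
    (w : (MvPowerSeries (Fin 2) R)ˣ) (a : ℤ) :
    φ ((w ^ a : (MvPowerSeries (Fin 2) R)ˣ) : MvPowerSeries (Fin 2) R) =
      (((Units.map φ.toMonoidHom w) ^ a : (IterLaurent R)ˣ) : IterLaurent R) := by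
  rw [← map_zpow]
  rfl

theorem diffInnerOuter_eq {F : FormalGroup R} {w : (MvPowerSeries (Fin 2) R)ˣ}
    (hw : diff F 0 1 = (X 0 - X 1 : MvPowerSeries (Fin 2) R) * (w : MvPowerSeries (Fin 2) R)) :
    diffInnerOuter F = subInnerOuter * Units.map (toIterHom (R := R)).toMonoidHom w := by
  ext1
  rw [Units.val_mul, val_subInnerOuter, ← toIterHom_apply]
  change toIter (diff F 0 1) = _
  rw [hw, ← toIterHom_apply, map_mul]
  rfl

theorem diffOuterInner_eq {F : FormalGroup R} {w : (MvPowerSeries (Fin 2) R)ˣ}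
    (hw : diff F 0 1 = (X 0 - X 1 : MvPowerSeries (Fin 2) R) * (w : MvPowerSeries (Fin 2) R)) :
    diffOuterInner F = subOuterInner *
      Units.map (toIterHom.comp (swapVars (R := R)).toRingHom).toMonoidHom w := by
  ext1
  rw [Units.val_mul, val_subOuterInner, ← toIterHom_apply]
  change toIter (diff F 1 0) = _
  rw [← diff_swap, ← swapVars_eq_subst, hw, map_mul, map_sub, swapVars_X_zero, swapVars_X_one,
    ← toIterHom_apply, map_mul]
  rfl

theorem toIterHom_swapVars_mul (p : PowerSeries R) :
    (toIterHom.comp (swapVars (R := R)).toRingHom) (p.toMvPowerSeries 0 * p.toMvPowerSeries 1) =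
      toIter (p.toMvPowerSeries 0 * p.toMvPowerSeries 1) := by
  have hswap : swapVars (p.toMvPowerSeries 0 * p.toMvPowerSeries 1) =
      p.toMvPowerSeries 0 * p.toMvPowerSeries 1 := by
    have h0 : swapVars (p.toMvPowerSeries 0) = p.toMvPowerSeries 1 := by
      rw [swapVars, rename_toMvPowerSeries, Equiv.swap_apply_left]
    have h1 : swapVars (p.toMvPowerSeries 1) = p.toMvPowerSeries 0 := by
      rw [swapVars, rename_toMvPowerSeries, Equiv.swap_apply_right]
    rw [map_mul, h0, h1, mul_comm]
  have h : (swapVars (R := R)).toRingHom (p.toMvPowerSeries 0 * p.toMvPowerSeries 1) =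
      p.toMvPowerSeries 0 * p.toMvPowerSeries 1 := hswap
  rw [RingHom.comp_apply, h, toIterHom_apply]

/-- The residue identity for the monomial `z₀ᵃ z₁ᵇ z₂ᶜ` and a formal group law. With
`F(x, ι(y)) = (x - y) w(x, y)`, it is the identity for `h (x₁ - x₂)ᵃ x₁ᵇ x₂ᶜ`, where
`h = wᵃ p_F(x₁) p_F(x₂)`; the Jacobian of `x₂ = F(x₁, ι(x₀))` turns `p_F(x₂)` into `p_F(x₀)`. -/
theorem iterRes_monomial_formalGroup (F : FormalGroup R) [F.IsComm] (a b c : ℤ) :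
    iterRes (toIter ((invDiff F).toMvPowerSeries 0 * (invDiff F).toMvPowerSeries 1) *
        ((diffInnerOuter F ^ a * innerVar ^ b * outerVar ^ c : (IterLaurent R)ˣ) : IterLaurent R))
      - iterRes (toIter ((invDiff F).toMvPowerSeries 0 * (invDiff F).toMvPowerSeries 1) *
        ((diffOuterInner F ^ a * outerVar ^ b * innerVar ^ c : (IterLaurent R)ˣ) :
          IterLaurent R)) =
      iterRes (toIter ((invDiff F).toMvPowerSeries 0 * (invDiff F).toMvPowerSeries 1) *
        ((outerVar ^ a * innerVar ^ b * diffInnerOuter F ^ c : (IterLaurent R)ˣ) :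
          IterLaurent R)) := by
  obtain ⟨w, hw⟩ := exists_diff_eq F
  set p := invDiff F
  have hs : MvPowerSeries.HasSubst ![X 0, diff F 0 1] :=
    hasSubst_pair (by simp) (constantCoeff_diff F 0 1)
  -- `x - Φ = y v` for `v = 1 / w(x, Φ)`, since `y = (x - Φ) w(x, Φ)`
  let w' : (MvPowerSeries (Fin 2) R)ˣ := Units.map (substAlgHom (R := R) hs).toRingHom.toMonoidHom w
  have hw' : (X 0 - diff F 0 1) * (w' : MvPowerSeries (Fin 2) R) = X 1 := by
    rw [← diff_subst_diff F]
    have h := congrArg (MvPowerSeries.subst ![X 0, diff F 0 1]) hw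
    rw [subst_mul hs, subst_sub hs, subst_X hs, subst_X hs] at h
    rw [h, ← substAlgHom_apply hs]
    rfl
  have hΦ : X 0 - diff F 0 1 = X 1 * ((w'⁻¹ : (MvPowerSeries (Fin 2) R)ˣ) :
      MvPowerSeries (Fin 2) R) := by
    rw [← hw', Units.mul_inv_cancel_right]
  obtain ⟨t, htw⟩ : ∃ t : (IterLaurent R)ˣ,
      t = outerVar * Units.map (toIterHom (R := R)).toMonoidHom w'⁻¹ := ⟨_, rfl⟩
  have ht : (t : IterLaurent R) = toIter (X 0 - diff F 0 1) := by
    rw [htw, hΦ, ← toIterHom_apply, map_mul, toIterHom_apply, ← val_outerVar_eq]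
    rfl
  have key := monomialRes_sub_monomialRes hΦ (t := t) (q := diffInnerOuter F) ht rfl hs a b c
    (((w ^ a : (MvPowerSeries (Fin 2) R)ˣ) : MvPowerSeries (Fin 2) R) *
      (p.toMvPowerSeries 0 * p.toMvPowerSeries 1))
  have hC : outerVar = t * Units.map
      (toIterHom.comp (substAlgHom (R := R) hs).toRingHom).toMonoidHom w := by
    have : Units.map (toIterHom.comp (substAlgHom (R := R) hs).toRingHom).toMonoidHom w =
      Units.map (toIterHom (R := R)).toMonoidHom w' := rfl
    rw [this, htw, mul_assoc, map_inv, inv_mul_cancel, mul_one]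
  have hinv : pderiv R 1 (X 0 - diff F 0 1) *
      substAlgHom (R := R) hs (p.toMvPowerSeries 0 * p.toMvPowerSeries 1) =
      p.toMvPowerSeries 0 * p.toMvPowerSeries 1 := by
    have h := pderiv_sub_diff_mul_invDiff F
    rw [substAlgHom_apply, subst_mul hs, PowerSeries.subst_toMvPowerSeries hs,
      PowerSeries.subst_toMvPowerSeries hs, PowerSeries.toMvPowerSeries_eq_subst,
      PowerSeries.toMvPowerSeries_eq_subst, ← h]
    simp only [Matrix.cons_val_zero, Matrix.cons_val_one]
    ring
  simp only [monomialRes_apply] at key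
  refine Eq.trans (congrArg₂ (· - ·) (congrArg iterRes ?_) (congrArg iterRes ?_))
    (key.trans (congrArg iterRes ?_))
  · rw [diffInnerOuter_eq hw, map_mul toIterHom, ringHom_val_zpow, toIterHom_apply, Units.val_mul,
      Units.val_mul, Units.val_mul, Units.val_mul, val_mul_zpow]
    ring
  · rw [diffOuterInner_eq hw, map_mul (toIterHom.comp (swapVars (R := R)).toRingHom),
      ringHom_val_zpow, toIterHom_swapVars_mul, Units.val_mul,
      Units.val_mul, Units.val_mul, Units.val_mul, val_mul_zpow]
    ring
  · have hJ : toIter (p.toMvPowerSeries 0 * p.toMvPowerSeries 1) =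
        toIter (pderiv R 1 (X 0 - diff F 0 1)) *
          (toIterHom.comp (substAlgHom (R := R) hs).toRingHom)
            (p.toMvPowerSeries 0 * p.toMvPowerSeries 1) := by
      conv_lhs => rw [← hinv]
      rw [← toIterHom_apply, ← toIterHom_apply, map_mul]
      rfl
    rw [map_mul (toIterHom.comp (substAlgHom (R := R) hs).toRingHom), ringHom_val_zpow, hJ, hC,
      Units.val_mul, Units.val_mul, Units.val_mul, Units.val_mul, val_mul_zpow]
    ring

end Identities

end FRes

end

/-- In each substitution, the expansion `i_{x,y}` takes place in `R((x))((y))`, and the residue in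
the outer variable `y` is taken first. -/
theorem mainTheorem2 {R : Type*} [CommRing R] :
    (∀ f : (Fin 3 → ℤ) → R,
      FRes.SubstConverges f ![FRes.subInnerOuter, FRes.innerVar, FRes.outerVar] →
      FRes.SubstConverges f ![FRes.subOuterInner, FRes.outerVar, FRes.innerVar] →
      FRes.SubstConverges f ![FRes.outerVar, FRes.innerVar, FRes.subInnerOuter] →
      FRes.residue (fun x₁ => FRes.residue fun x₂ =>
          FRes.substitute f ![FRes.subInnerOuter, FRes.innerVar, FRes.outerVar] x₁ x₂)
        - FRes.residue (fun x₂ => FRes.residue fun x₁ =>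
          FRes.substitute f ![FRes.subOuterInner, FRes.outerVar, FRes.innerVar] x₂ x₁)
        = FRes.residue (fun x₁ => FRes.residue fun x₀ =>
          FRes.substitute f ![FRes.outerVar, FRes.innerVar, FRes.subInnerOuter] x₁ x₀)) ∧
    (∀ (F : FormalGroup R) [F.IsComm] (f : (Fin 3 → ℤ) → R),
      FRes.FSubstConverges F f ![FRes.diffInnerOuter F, FRes.innerVar, FRes.outerVar] →
      FRes.FSubstConverges F f ![FRes.diffOuterInner F, FRes.outerVar, FRes.innerVar] →
      FRes.FSubstConverges F f ![FRes.outerVar, FRes.innerVar, FRes.diffInnerOuter F] →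
      FRes.fResidue F (fun z₁ => FRes.fResidue F fun z₂ =>
          FRes.substitute f ![FRes.diffInnerOuter F, FRes.innerVar, FRes.outerVar] z₁ z₂)
        - FRes.fResidue F (fun z₂ => FRes.fResidue F fun z₁ =>
          FRes.substitute f ![FRes.diffOuterInner F, FRes.outerVar, FRes.innerVar] z₂ z₁)
        = FRes.fResidue F (fun z₁ => FRes.fResidue F fun z₀ =>
          FRes.substitute f ![FRes.outerVar, FRes.innerVar, FRes.diffInnerOuter F] z₁ z₀)) := by
  refine ⟨fun f h₁ h₂ _ => ?_, fun F _ f h₁ h₂ h₃ => ?_⟩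
  · refine FRes.finsum_sub_eq_finsum (h₁ (-1) (-1)) (h₂ (-1) (-1)) fun e => ?_
    rw [FRes.iterCoeff_substTerm, FRes.iterCoeff_substTerm, FRes.iterCoeff_substTerm, ← mul_sub]
    exact congrArg (f e * ·) (FRes.iterRes_monomial_additive (e 0) (e 1) (e 2))
  · rw [(FRes.fResidue_fResidue_substitute h₁).1, (FRes.fResidue_fResidue_substitute h₂).1,
      (FRes.fResidue_fResidue_substitute h₃).1]
    refine FRes.finsum_sub_eq_finsum (FRes.fResidue_fResidue_substitute h₁).2
      (FRes.fResidue_fResidue_substitute h₂).2 fun e => ?_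
    rw [← mul_sub, FRes.iterRes_monomial_formalGroup F (e 0) (e 1) (e 2)]
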